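/- Let $\mathbf G$ be a nonempty indexing category: a finite category in which there is at most one morphism from $i$ to $j$ for any two objects $i,j$, and in which any two objects $i,j$ have a minimal common ancestor, i.e. an object $k$ with morphisms $k\to i$, $k\to j$ such that every object with morphisms to both $i$ and $j$ has a morphism to $k$. Write $|\mathbf G|$ for its number of objects and $0$ for its initial object. A finite probability space is a set with a finitely supported probability distribution; a reduction is a measure-preserving map, up to equality on a set of full measure; a $\mathbf G$-diagram is a functor from $\mathbf G$ to the category of finite probability spaces and reductions, and reductions of $\mathbf G$-diagrams are natural transformations. $H$ denotes Shannon entropy. Tensor products and powers of diagrams are formed by independent products. For $\mathbf G$-diagrams $\mathcal X,\mathcal Y$ put $$\mathbf k(\mathcal X,\mathcal Y)=\inf_{\mathcal X\leftarrow\mathcal Z\to\mathcal Y}\ \sum_{i\in\mathbf G}\Big(|H(Z_i)-H(X_i)|+|H(Z_i)-H(Y_i)|\Big),$$ the infimum being over all pairs of reductions of $\mathbf G$-diagrams with common domain $\mathcal Z$. For sequences of $\mathbf G$-diagrams the asymptotic entropy distance is $\boldsymbol\kappa(\bar{\mathcal X},\bar{\mathcal Y})=\lim_{n\to\infty}\frac1n\mathbf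 k(\mathcal X(n),\mathcal Y(n))$, and for diagrams $\boldsymbol\kappa(\mathcal X,\mathcal Y)$ is that of the sequences $(\mathcal X^n)_n,(\mathcal Y^n)_n$. A function $\varphi:[1,\infty)\to[0,\infty)$ is admissible if it is non-decreasing and, for some constant $D$, $8t\int_t^\infty\varphi(s)s^{-2}\,ds\le D\varphi(t)$ for all $t\ge1$. A sequence $(\mathcal X(n))_{n\ge0}$ is quasi-linear if $\boldsymbol\kappa(\mathcal X(n+m),\mathcal X(n)\otimes\mathcal X(m))\le C\varphi(n+m)$ for some constant $C$, some admissible $\varphi$ and all $n,m\ge0$ with $n+m\ge1$. A tropical diagram is a class of quasi-linear sequences with respect to the equivalence relation $\boldsymbol\kappa(\bar{\mathcal X},\bar{\mathcal Y})=0$. Let $\mathcal A$ be a $\mathbf G$-diagram and let $E=A_\iota$ be a space in it, with distribution $p$. For an atom $u$ of $E$ (a point with $p(u)>0$), $\mathcal A|u$ is the diagram with the same sets and maps as $\mathcal A$, where the distribution on $A_0$ is conditioned on the preimage of $u$ under $A_0\to E$, and the distributions on the other spaces are the push-forwards of it. Let $\vec{\mathcal A}$ be the tropical diagram represented by the linear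 sequence $(\mathcal A^n)_n$ and let $[\mathcal A|E]=\int_E\overrightarrow{\mathcal A|u}\,dp(u)$ be the tropical diagram represented by the sequence $\mathcal Y(n)=\bigotimes_u(\mathcal A|u)^{\lfloor n\,p(u)\rfloor}$, the product being over the atoms $u$ of $E$. **Corollary.** Both sequences $(\mathcal A^n)_n$ and $(\mathcal Y(n))_n$ are quasi-linear, so that they represent tropical diagrams; the asymptotic entropy distance $\boldsymbol\kappa(\vec{\mathcal A},[\mathcal A|E])$ exists, i.e. for all representatives of the two tropical diagrams the limit defining it exists, with the same value; and $$\boldsymbol\kappa\big(\vec{\mathcal A},[\mathcal A|E]\big)\ \le\ 2\,|\mathbf G|\,H(E).$$ -/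

import Mathlib

open CategoryTheory Filter Topology Convexity

universe u v w w'

noncomputable section

namespace TropicalProb

/-! ## Finite probability spaces and reductions -/

/-- A finite probability space: a set with a finitely supported probability distribution. -/
structure FinProb : Type (u + 1) where
  carrier : Type u
  law : StdSimplex ℝ carrier

namespace FinProb

/-- `X.p x` is the probability of the point `x`. -/
def p (X : FinProb.{u}) (x : X.carrier) : ℝ := X.law.weights x

/-- The atoms of a probability space: the points of positive weight. -/
abbrev Atom (X : FinProb.{u}) : Type u := {x : X.carrier // x ∈ X.law.weights.support}

/-- Shannon entropy, `H(X) = - ∑ p(x) log p(x)`, the sum being over the atoms. -/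
def entropy (X : FinProb.{u}) : ℝ := ∑ x ∈ X.law.weights.support, Real.negMulLog (X.p x)

/-- Measure-preserving maps: those that push the law of `X` forward to the law of `Y`. -/
abbrev MPMap (X Y : FinProb.{u}) : Type u :=
  {f : X.carrier → Y.carrier // X.law.map f = Y.law}

/-- Two measure-preserving maps are equivalent if they coincide on a set of full measure,
that is, on all atoms. -/
instance mpSetoid (X Y : FinProb.{u}) : Setoid (MPMap X Y) where
  r f g := ∀ x ∈ X.law.weights.support, f.1 x = g.1 x
  iseqv := ⟨fun _ _ _ => rfl, fun h x hx => (h x hx).symm,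
    fun h h' x hx => (h x hx).trans (h' x hx)⟩

/-- A reduction is an equivalence class of measure-preserving maps. -/
abbrev Reduction (X Y : FinProb.{u}) : Type u := Quotient (mpSetoid X Y)

theorem weights_map_eq {α β : Type*} [DecidableEq β] (l : StdSimplex ℝ α) (f : α → β) (y : β) :
    (l.map f).weights y = ∑ x ∈ l.weights.support with f x = y, l.weights x := by
  rw [StdSimplex.weights_map, Finsupp.mapDomain, Finsupp.sum_apply, Finsupp.sum,
    Finset.sum_filter]
  exact Finset.sum_congr rfl fun a _ => by rw [Finsupp.single_apply]

theorem map_mem_support {α β : Type*} (l : StdSimplex ℝ α) (f : α → β) {x : α}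
    (hx : x ∈ l.weights.support) : f x ∈ (l.map f).weights.support := by
  classical
  rw [Finsupp.mem_support_iff, weights_map_eq]
  have h : 0 < l.weights x :=
    lt_of_le_of_ne (l.nonneg x) (Ne.symm (Finsupp.mem_support_iff.1 hx))
  have h3 : 0 < ∑ a ∈ l.weights.support with f a = f x, l.weights a :=
    Finset.sum_pos' (fun a _ => l.nonneg a) ⟨x, Finset.mem_filter.2 ⟨hx, rfl⟩, h⟩
  exact h3.ne'

theorem exists_of_mem_support_map {α β : Type*} (l : StdSimplex ℝ α) (f : α → β) {y : β}
    (hy : y ∈ (l.map f).weights.support) : ∃ x ∈ l.weights.support, f x = y := by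
  classical
  rw [StdSimplex.weights_map] at hy
  simpa using Finsupp.mapDomain_support hy

theorem map_congr {α β : Type*} (l : StdSimplex ℝ α) {f g : α → β}
    (h : ∀ x ∈ l.weights.support, f x = g x) : l.map f = l.map g := by
  ext1
  simpa using Finsupp.mapDomain_congr h

theorem MPMap.mem {X Y : FinProb.{u}} (f : MPMap X Y) {x : X.carrier}
    (hx : x ∈ X.law.weights.support) : f.1 x ∈ Y.law.weights.support := by
  have := map_mem_support X.law f.1 hx
  rwa [f.2] at this

/-- Composition of measure-preserving maps. -/
def MPMap.comp {X Y Z : FinProb.{u}} (f : MPMap X Y) (g : MPMap Y Z) : MPMap X Z :=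
  ⟨g.1 ∘ f.1, by rw [StdSimplex.map_comp, f.2, g.2]⟩

/-- The category of finite probability spaces and reductions. -/
instance category : Category.{u} FinProb.{u} where
  Hom X Y := Reduction X Y
  id X := Quotient.mk _ ⟨id, StdSimplex.map_id _⟩
  comp := Quotient.map₂ MPMap.comp fun f f' hf g g' hg x hx => by
    show g.1 (f.1 x) = g'.1 (f'.1 x)
    rw [← hf x hx]
    exact hg _ (f.mem hx)
  id_comp f := by induction f using Quotient.inductionOn; rfl
  comp_id f := by induction f using Quotient.inductionOn; rfl
  assoc f g h := by
    induction f using Quotient.inductionOn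
    induction g using Quotient.inductionOn
    induction h using Quotient.inductionOn
    rfl

/-- The reduction represented by a measure-preserving map. -/
def MPMap.toHom {X Y : FinProb.{u}} (f : MPMap X Y) : X ⟶ Y := Quotient.mk (mpSetoid X Y) f

/-- A measure-preserving map representing a reduction. -/
def rep {X Y : FinProb.{u}} (f : X ⟶ Y) : MPMap X Y := Quotient.out (s := mpSetoid X Y) f

theorem toHom_rep {X Y : FinProb.{u}} (f : X ⟶ Y) : (rep f).toHom = f :=
  Quotient.out_eq (s := mpSetoid X Y) f

theorem toHom_eq {X Y : FinProb.{u}} {f g : MPMap X Y} :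
    f.toHom = g.toHom ↔ ∀ x ∈ X.law.weights.support, f.1 x = g.1 x :=
  Quotient.eq (r := mpSetoid X Y)

theorem toHom_comp {X Y Z : FinProb.{u}} (f : MPMap X Y) (g : MPMap Y Z) :
    f.toHom ≫ g.toHom = (f.comp g).toHom := rfl

theorem toHom_id (X : FinProb.{u}) :
    𝟙 X = MPMap.toHom (⟨id, StdSimplex.map_id _⟩ : MPMap X X) := rfl

theorem rep_id {X : FinProb.{u}} {x : X.carrier} (hx : x ∈ X.law.weights.support) :
    (rep (𝟙 X)).1 x = x :=
  toHom_eq.1 ((toHom_rep (𝟙 X)).trans (toHom_id X)) x hx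

theorem rep_comp {X Y Z : FinProb.{u}} (f : X ⟶ Y) (g : Y ⟶ Z) {x : X.carrier}
    (hx : x ∈ X.law.weights.support) : (rep (f ≫ g)).1 x = (rep g).1 ((rep f).1 x) := by
  have h : (rep (f ≫ g)).toHom = ((rep f).comp (rep g)).toHom := by
    rw [← toHom_comp, toHom_rep, toHom_rep, toHom_rep]
  exact toHom_eq.1 h x hx

/-! ## Tensor products of probability spaces -/

/-- The product of two distributions. -/
def prodDist {α β : Type*} (l : StdSimplex ℝ α) (m : StdSimplex ℝ β) : StdSimplex ℝ (α × β) where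
  weights := Finsupp.onFinset (l.weights.support ×ˢ m.weights.support)
    (fun z => l.weights z.1 * m.weights z.2)
    (fun z hz => by
      simp only [Finset.mem_product, Finsupp.mem_support_iff]
      exact ⟨left_ne_zero_of_mul hz, right_ne_zero_of_mul hz⟩)
  nonneg := fun z => mul_nonneg (l.nonneg _) (m.nonneg _)
  total := by
    rw [Finsupp.onFinset_sum _ (fun _ => rfl), Finset.sum_product]
    have hX : ∑ x ∈ l.weights.support, l.weights x = 1 := l.total
    have hY : ∑ x ∈ m.weights.support, m.weights x = 1 := m.total
    simp only [← Finset.mul_sum, hY, mul_one, hX]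

/-- The product of a finite family of distributions. -/
def piDist {K : Type*} [Fintype K] {α : K → Type*} (l : ∀ k, StdSimplex ℝ (α k)) :
    StdSimplex ℝ (∀ k, α k) where
  weights := by
    classical
    exact Finsupp.onFinset (Fintype.piFinset fun k => (l k).weights.support)
      (fun x => ∏ k, (l k).weights (x k))
      (fun x hx => by
        simp only [Fintype.mem_piFinset, Finsupp.mem_support_iff]
        exact fun k => Finset.prod_ne_zero_iff.1 hx k (Finset.mem_univ k))
  nonneg := fun x => Finset.prod_nonneg fun k _ => (l k).nonneg _
  total := by
    classical
    rw [Finsupp.onFinset_sum _ (fun _ => rfl), ← Finset.prod_univ_sum]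
    exact Finset.prod_eq_one fun k _ => (l k).total

theorem prodDist_weights {α β : Type*} (l : StdSimplex ℝ α) (m : StdSimplex ℝ β) (z : α × β) :
    (prodDist l m).weights z = l.weights z.1 * m.weights z.2 := rfl

theorem piDist_weights {K : Type*} [Fintype K] {α : K → Type*} (l : ∀ k, StdSimplex ℝ (α k))
    (x : ∀ k, α k) : (piDist l).weights x = ∏ k, (l k).weights (x k) := rfl

theorem mem_support_prodDist {α β : Type*} (l : StdSimplex ℝ α) (m : StdSimplex ℝ β)
    (z : α × β) : z ∈ (prodDist l m).weights.support ↔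
      z.1 ∈ l.weights.support ∧ z.2 ∈ m.weights.support := by
  simp only [Finsupp.mem_support_iff, prodDist_weights, mul_ne_zero_iff]

theorem mem_support_piDist {K : Type*} [Fintype K] {α : K → Type*} (l : ∀ k, StdSimplex ℝ (α k))
    (x : ∀ k, α k) :
    x ∈ (piDist l).weights.support ↔ ∀ k, x k ∈ (l k).weights.support := by
  simp only [Finsupp.mem_support_iff, piDist_weights, Finset.prod_ne_zero_iff, Finset.mem_univ,
    true_implies]

theorem prodDist_map {α β α' β' : Type*} (l : StdSimplex ℝ α) (m : StdSimplex ℝ β)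
    (f : α → α') (g : β → β') :
    (prodDist l m).map (fun z => (f z.1, g z.2)) = prodDist (l.map f) (m.map g) := by
  classical
  ext y
  rw [prodDist_weights, weights_map_eq, weights_map_eq, weights_map_eq, Finset.sum_mul_sum,
    ← Finset.sum_product']
  refine Finset.sum_congr ?_ fun z _ => rfl
  ext z
  simp only [Finset.mem_filter, Finset.mem_product, mem_support_prodDist, Prod.ext_iff]
  tauto

theorem piDist_map {K : Type*} [Fintype K] {α β : K → Type*} (l : ∀ k, StdSimplex ℝ (α k))
    (f : ∀ k, α k → β k) :
    (piDist l).map (fun x k => f k (x k)) = piDist fun k => (l k).map (f k) := by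
  classical
  ext y
  simp only [piDist_weights, weights_map_eq, Finset.prod_univ_sum]
  refine Finset.sum_congr ?_ fun z _ => rfl
  ext z
  simp only [Finset.mem_filter, Fintype.mem_piFinset, mem_support_piDist, funext_iff]
  exact forall_and.symm

/-- The tensor product (independent product) of two probability spaces. -/
abbrev tensor (X Y : FinProb.{u}) : FinProb.{u} := ⟨X.carrier × Y.carrier, prodDist X.law Y.law⟩

/-- The tensor product (independent product) of a finite family of probability spaces. -/
abbrev tensorFam {K : Type v} [Fintype K] (X : K → FinProb.{u}) : FinProb.{max v u} :=
  ⟨∀ k, (X k).carrier, piDist fun k => (X k).law⟩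

/-- The product of two measure-preserving maps. -/
def MPMap.tensor {X Y X' Y' : FinProb.{u}} (f : MPMap X Y) (g : MPMap X' Y') :
    MPMap (FinProb.tensor X X') (FinProb.tensor Y Y') :=
  ⟨fun z => (f.1 z.1, g.1 z.2), by rw [prodDist_map, f.2, g.2]⟩

/-- The product of a finite family of measure-preserving maps. -/
def MPMap.tensorFam {K : Type v} [Fintype K] {X Y : K → FinProb.{u}}
    (f : ∀ k, MPMap (X k) (Y k)) : MPMap (FinProb.tensorFam X) (FinProb.tensorFam Y) :=
  ⟨fun x k => (f k).1 (x k), by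
    rw [piDist_map (fun k => (X k).law)]
    exact congrArg piDist (funext fun k => (f k).2)⟩

end FinProb

/-! ## Indexing categories and diagrams -/

/-- An indexing category (the finiteness of its set of objects is a separate instance argument):
between two objects there is at most one morphism, and any two objects have a minimal common
ancestor, where `i` is an ancestor of `j` if there is a morphism `i ⟶ j`.
Finite posets with binary infima, seen as categories, are the basic example. -/
class IndexingCategory (G : Type v) [Category.{w} G] : Prop where
  thin : ∀ i j : G, Subsingleton (i ⟶ j)
  exists_minimal_common_ancestor : ∀ i j : G, ∃ k : G,
    Nonempty (k ⟶ i) ∧ Nonempty (k ⟶ j) ∧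
      ∀ l : G, Nonempty (l ⟶ i) → Nonempty (l ⟶ j) → Nonempty (l ⟶ k)

/-- A `G`-diagram of probability spaces: a functor from `G` to the category of finite probability
spaces and reductions. Morphisms (reductions of diagrams) are natural transformations. -/
abbrev Diagram (G : Type v) [Category.{w} G] := G ⥤ FinProb.{u}

section Diagrams

variable {G : Type v} [Category.{w} G]

/-- A nonempty indexing category has an initial object, i.e. an ancestor of all objects. -/
theorem exists_initial [Fintype G] [IndexingCategory G] [Nonempty G] :
    ∃ i₀ : G, ∀ i : G, Nonempty (i₀ ⟶ i) := by
  classical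
  suffices h : ∀ s : Finset G, ∃ i₀ : G, ∀ i ∈ s, Nonempty (i₀ ⟶ i) by
    obtain ⟨i₀, h⟩ := h Finset.univ
    exact ⟨i₀, fun i => h i (Finset.mem_univ i)⟩
  intro s
  induction s using Finset.induction_on with
  | empty => exact ⟨Classical.arbitrary G, by simp⟩
  | insert a s _ ih =>
    obtain ⟨j, hj⟩ := ih
    obtain ⟨k, ⟨ka⟩, ⟨kj⟩, _⟩ := IndexingCategory.exists_minimal_common_ancestor a j
    refine ⟨k, fun i hi => ?_⟩
    rcases Finset.mem_insert.1 hi with rfl | hi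
    · exact ⟨ka⟩
    · exact ⟨kj ≫ (hj i hi).some⟩

/-- The initial object of a nonempty indexing category. -/
def initialObj (G : Type v) [Category.{w} G] [Fintype G] [IndexingCategory G] [Nonempty G] : G :=
  (exists_initial (G := G)).choose

/-- The morphism from the initial object. -/
def fromInitial [Fintype G] [IndexingCategory G] [Nonempty G] (i : G) : initialObj G ⟶ i :=
  ((exists_initial (G := G)).choose_spec i).some

namespace Diagram

/-- The tensor product of two diagrams. -/
def tensor (X Y : Diagram.{u} G) : Diagram.{u} G where
  obj i := FinProb.tensor (X.obj i) (Y.obj i)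
  map f := ((FinProb.rep (X.map f)).tensor (FinProb.rep (Y.map f))).toHom
  map_id i := by
    rw [FinProb.toHom_id, FinProb.toHom_eq]
    intro z hz
    replace hz := (FinProb.mem_support_prodDist _ _ z).1 hz
    rw [X.map_id, Y.map_id]
    exact Prod.ext (FinProb.rep_id hz.1) (FinProb.rep_id hz.2)
  map_comp f g := by
    rw [FinProb.toHom_comp, FinProb.toHom_eq]
    intro z hz
    replace hz := (FinProb.mem_support_prodDist _ _ z).1 hz
    rw [X.map_comp, Y.map_comp]
    exact Prod.ext (FinProb.rep_comp _ _ hz.1) (FinProb.rep_comp _ _ hz.2)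

/-- The tensor product of a finite family of diagrams. -/
def tensorFam {K : Type w'} [Fintype K] (X : K → Diagram.{u} G) : Diagram.{max w' u} G where
  obj i := FinProb.tensorFam fun k => (X k).obj i
  map f := (FinProb.MPMap.tensorFam fun k => FinProb.rep ((X k).map f)).toHom
  map_id i := by
    rw [FinProb.toHom_id, FinProb.toHom_eq]
    intro z hz
    replace hz := (FinProb.mem_support_piDist _ z).1 hz
    funext k
    have h := FinProb.rep_id (hz k)
    rw [← (X k).map_id] at h
    exact h
  map_comp f g := by
    rw [FinProb.toHom_comp, FinProb.toHom_eq]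
    intro z hz
    replace hz := (FinProb.mem_support_piDist _ z).1 hz
    funext k
    have h := FinProb.rep_comp ((X k).map f) ((X k).map g) (hz k)
    rw [← (X k).map_comp] at h
    exact h

/-- The tensor power `X ^ n`. -/
def power (X : Diagram.{u} G) (n : ℕ) : Diagram.{u} G := tensorFam.{u, v, w, 0} fun _ : Fin n => X

/-! ## Conditioning -/

section Conditioning

variable [Fintype G] [IndexingCategory G] [Nonempty G]

/-- The conditioned distribution `π₀(· | u)` on the initial space `X₀` of `X`, for an atom `u` of
the space `U = X_ι` of `X`: the law of `X₀` restricted to the preimage of `u` under the reduction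
`X₀ → U` and renormalized. -/
def condInitial (X : Diagram.{u} G) (ι : G) (a : (X.obj ι).Atom) :
    StdSimplex ℝ (X.obj (initialObj G)).carrier :=
  (X.obj (initialObj G)).law.restrict
    ((FinProb.rep (X.map (fromInitial ι))).1 ⁻¹' {a.1}) (by
      obtain ⟨x, hx, hxa⟩ := FinProb.exists_of_mem_support_map _ _
        ((congrArg (fun l => a.1 ∈ l.weights.support)
          (FinProb.rep (X.map (fromInitial ι))).2).mpr a.2)
      exact ⟨x, hxa, Finsupp.mem_support_iff.1 hx⟩)

theorem mem_support_of_condInitial (X : Diagram.{u} G) (ι : G) (a : (X.obj ι).Atom)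
    {x : (X.obj (initialObj G)).carrier} (hx : x ∈ (condInitial X ι a).weights.support) :
    x ∈ (X.obj (initialObj G)).law.weights.support := by
  classical
  rw [condInitial, StdSimplex.weights_restrict] at hx
  have h := Finsupp.support_smul hx
  rw [Finsupp.support_filter] at h
  exact (Finset.mem_filter.1 h).1

/-- The conditioned distribution on the space `X_i`: the image of `π₀(· | u)` under the reduction
from the initial space. -/
def condLaw (X : Diagram.{u} G) (ι : G) (a : (X.obj ι).Atom) (i : G) :
    StdSimplex ℝ (X.obj i).carrier :=
  (condInitial X ι a).map (FinProb.rep (X.map (fromInitial i))).1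

theorem mem_support_of_condLaw (X : Diagram.{u} G) (ι : G) (a : (X.obj ι).Atom) {i : G}
    {x : (X.obj i).carrier} (hx : x ∈ (condLaw X ι a i).weights.support) :
    x ∈ (X.obj i).law.weights.support := by
  obtain ⟨y, hy, rfl⟩ := FinProb.exists_of_mem_support_map _ _ hx
  exact FinProb.MPMap.mem _ (mem_support_of_condInitial X ι a hy)

theorem condLaw_map (X : Diagram.{u} G) (ι : G) (a : (X.obj ι).Atom) {i j : G} (f : i ⟶ j) :
    (condLaw X ι a i).map (FinProb.rep (X.map f)).1 = condLaw X ι a j := by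
  rw [condLaw, condLaw, ← StdSimplex.map_comp]
  refine FinProb.map_congr _ fun x hx => ?_
  have h := FinProb.rep_comp (X.map (fromInitial i)) (X.map f) (mem_support_of_condInitial X ι a hx)
  have hf : fromInitial i ≫ f = fromInitial j :=
    (IndexingCategory.thin (initialObj G) j).elim _ _
  rw [← X.map_comp, hf] at h
  exact h.symm

/-- The conditioned diagram `X | u`, for an atom `u` of the space `X_ι` of `X`: the sets and the
maps are those of `X`, the distributions are the conditioned ones. -/
def cond (X : Diagram.{u} G) (ι : G) (a : (X.obj ι).Atom) : Diagram.{u} G where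
  obj i := ⟨(X.obj i).carrier, condLaw X ι a i⟩
  map f := FinProb.MPMap.toHom ⟨(FinProb.rep (X.map f)).1, condLaw_map X ι a f⟩
  map_id i := by
    rw [FinProb.toHom_id, FinProb.toHom_eq]
    intro x hx
    have h := FinProb.rep_id (mem_support_of_condLaw X ι a hx)
    rw [← X.map_id] at h
    exact h
  map_comp f g := by
    rw [FinProb.toHom_comp, FinProb.toHom_eq]
    intro x hx
    have h := FinProb.rep_comp (X.map f) (X.map g) (mem_support_of_condLaw X ι a hx)
    rw [← X.map_comp] at h
    exact h

end Conditioning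

/-! ## Entropy distance -/

/-- A fan `X ← Z → Y` of diagrams. -/
structure Fan (X Y : Diagram.{u} G) where
  top : Diagram.{u} G
  left : top ⟶ X
  right : top ⟶ Y

/-- The `ℓ¹`-distance between the entropy vectors of two diagrams. -/
def entropyL1 [Fintype G] (X Y : Diagram.{u} G) : ℝ :=
  ∑ i : G, |(X.obj i).entropy - (Y.obj i).entropy|

/-- The entropy distance of a fan. -/
def Fan.kd [Fintype G] {X Y : Diagram.{u} G} (K : Fan X Y) : ℝ :=
  entropyL1 K.top X + entropyL1 K.top Y

/-- The intrinsic entropy distance: the infimum of the entropy distances of all fans from a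
diagram to `X` and `Y` (there is always one, given by the tensor product). -/
def ikd [Fintype G] (X Y : Diagram.{u} G) : ℝ := ⨅ K : Fan X Y, K.kd

end Diagram

/-! ## Tropical diagrams -/

/-- Sequences of diagrams. -/
abbrev DiagramSeq (G : Type v) [Category.{w} G] := ℕ → Diagram.{u} G

namespace DiagramSeq

open Diagram

/-- `d` is the asymptotic entropy distance between two sequences: the limit
`lim (1/n) ikd (X n) (Y n)` exists and equals `d`. -/
def HasAsympDist [Fintype G] (X Y : DiagramSeq.{u} G) (d : ℝ) : Prop :=
  Tendsto (fun n : ℕ => ikd (X n) (Y n) / n) atTop (𝓝 d)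

/-- The linear sequence `n ↦ X ^ n` generated by a diagram `X`. -/
def linear (X : Diagram.{u} G) : DiagramSeq.{u} G := fun n => X.power n

/-- The termwise tensor product of a finite family of sequences, representing the sum of tropical
diagrams. -/
def sum {K : Type u} [Fintype K] (X : K → DiagramSeq.{u} G) : DiagramSeq.{u} G :=
  fun n => tensorFam.{u, v, w, u} fun k => X k n

/-- Rescaling by a nonnegative real number `c`, `n ↦ X ⌊c n⌋`, representing the action of the
nonnegative reals on tropical diagrams. -/
def scale (c : ℝ) (X : DiagramSeq.{u} G) : DiagramSeq.{u} G := fun n => X ⌊c * n⌋₊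

/-- The sequence `n ↦ ⨂ u, (X | u) ^ ⌊n p(u)⌋` representing `[X | U]`, the average over the atoms
`u` of `U = X_ι` of the tropical diagrams generated by `X | u`. -/
def cond [Fintype G] [IndexingCategory G] [Nonempty G] (X : Diagram.{u} G) (ι : G) :
    DiagramSeq.{u} G :=
  sum fun a : (X.obj ι).Atom => scale ((X.obj ι).p a.1) (linear (X.cond ι a))

/-- A function on `[1, ∞)` with nonnegative values is admissible if it is non-decreasing and there
is a constant `D` with `8 t ∫_t^∞ φ(s) / s² ds ≤ D φ(t)` for all `t ≥ 1`. -/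
def Admissible (φ : ℝ → ℝ) : Prop :=
  (∀ t, 1 ≤ t → 0 ≤ φ t) ∧ MonotoneOn φ (Set.Ici 1) ∧
    ∃ D : ℝ, ∀ t, 1 ≤ t →
      MeasureTheory.IntegrableOn (fun s => φ s / s ^ 2) (Set.Ioi t) ∧
        8 * t * (∫ s in Set.Ioi t, φ s / s ^ 2) ≤ D * φ t

/-- A sequence is quasi-linear if the defect, the asymptotic distance between `X (n + m)` and
`X n ⊗ X m`, is bounded by a multiple of `φ (n + m)` for some admissible function `φ`. -/
def QuasiLinear [Fintype G] (X : DiagramSeq.{u} G) : Prop :=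
  ∃ φ : ℝ → ℝ, Admissible φ ∧ ∃ C : ℝ, ∀ n m : ℕ, 1 ≤ n + m →
    ∃ d : ℝ, HasAsympDist (linear (X (n + m))) (linear ((X n).tensor (X m))) d ∧
      d ≤ C * φ (n + m)

/-- The tropical diagram `[X]` of a sequence `X`: the class of all quasi-linear sequences that are
asymptotically equivalent to `X`, i.e. at asymptotic distance `0` from it. -/
def tropicalClass [Fintype G] (X : DiagramSeq.{u} G) : Set (DiagramSeq.{u} G) :=
  {Y | QuasiLinear Y ∧ HasAsympDist X Y 0}

end DiagramSeq

end Diagrams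

end TropicalProb

end

open TropicalProb

/-! Compare `A ^ n` with `Y(n)` through an intermediate diagram. Draw a word `e` of `n` independent
atoms of `E` and, given `e`, take the tensor product of the conditioned diagrams `A | e_k`; let `W`
be the mixture of these products over all words (`wordMix`). By the law of total probability,
forgetting the word is a reduction `W → A ^ n`. The word has entropy `n H(E)`, so on each space this
reduction loses at most that much, and the distance from `W` to `A ^ n` is at most `|G| n H(E)`
(`ikd_wordMix_le`).

In the other direction, mixing near-optimal fans from the components of `W` to a fixed diagram gives
a fan from `W`. Its cost is the mean cost of the components plus once more the entropy of the word
on each space (`ikd_mix_le`). For the target `Y(n)` the mean cost is small: two products of the same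
factors differ only by the multiplicities of the factors (`ikd_tensorFam_le`), and the number of
occurrences of an atom `a` in a random word deviates on average by at most `√n` from `n p(a)`
(`sum_piDist_mul_abs_count_le`). Hence the distance from `A ^ n` to `Y(n)` is at most `2 |G| H(E) n
+ O(√n + 1)`, and division by `n` gives the constant.

The limit exists because `n ↦ A ^ n` is additive up to distance zero and `Y` is additive up to a
bounded error caused by the floors. The distances between them are therefore subadditive up to a
constant, and Fekete's lemma applies. The same estimates give quasi-linearity with constant `φ`, and
the triangle inequality makes the limit independent of representatives.

The triangle inequality itself is proved by amalgamating two fans over their common end: the initial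
spaces are coupled independently over the initial space of the middle diagram, the coupling is
pushed forward to the other spaces, and submodularity of entropy (`shannon_submodular`) bounds the
cost. -/

noncomputable section
namespace TropicalProb
namespace FinProb

/-! ## Distributions and Shannon entropy -/

section Distributions

variable {α β γ δ : Type*}

/-- Shannon entropy of a finitely supported distribution. -/
def shannon (l : StdSimplex ℝ α) : ℝ := ∑ x ∈ l.weights.support, Real.negMulLog (l.weights x)

theorem entropy_eq_shannon (X : FinProb.{u}) : X.entropy = shannon X.law := rfl

theorem weights_pos (l : StdSimplex ℝ α) {x : α} (hx : x ∈ l.weights.support) :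
    0 < l.weights x :=
  lt_of_le_of_ne (l.nonneg x) (Ne.symm (Finsupp.mem_support_iff.1 hx))

theorem sum_weights (l : StdSimplex ℝ α) : ∑ x ∈ l.weights.support, l.weights x = 1 := l.total

theorem sum_weights_univ [Fintype α] (l : StdSimplex ℝ α) : ∑ x, l.weights x = 1 := by
  rw [← sum_weights l]
  exact (Finset.sum_subset (Finset.subset_univ _) fun x _ hx => by simpa using hx).symm

theorem shannon_univ [Fintype α] (l : StdSimplex ℝ α) :
    shannon l = ∑ x, Real.negMulLog (l.weights x) :=
  Finset.sum_subset (Finset.subset_univ _) fun x _ hx => by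
    rw [Finsupp.notMem_support_iff.1 hx, Real.negMulLog_zero]

theorem weights_le_one (l : StdSimplex ℝ α) (x : α) : l.weights x ≤ 1 := by
  by_cases hx : x ∈ l.weights.support
  · rw [← sum_weights l]
    exact Finset.single_le_sum (f := fun x => l.weights x) (fun a _ => l.nonneg a) hx
  · rw [Finsupp.notMem_support_iff.1 hx]
    exact zero_le_one

theorem shannon_nonneg (l : StdSimplex ℝ α) : 0 ≤ shannon l :=
  Finset.sum_nonneg fun x _ => Real.negMulLog_nonneg (l.nonneg x) (weights_le_one l x)

theorem sum_weights_map (l : StdSimplex ℝ α) (f : α → β) (F : β → ℝ) :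
    ∑ y ∈ (l.map f).weights.support, (l.map f).weights y * F y =
      ∑ x ∈ l.weights.support, l.weights x * F (f x) := by
  have h := Finsupp.sum_mapDomain_index (f := f) (s := l.weights) (h := fun b m => m * F b)
    (fun b => zero_mul _) (fun b m n => add_mul _ _ _)
  rw [← StdSimplex.weights_map] at h
  exact h

theorem shannon_map (l : StdSimplex ℝ α) (f : α → β) :
    shannon (l.map f) =
      -∑ x ∈ l.weights.support, l.weights x * Real.log ((l.map f).weights (f x)) := by
  rw [← sum_weights_map l f fun y => Real.log ((l.map f).weights y), shannon,
    ← Finset.sum_neg_distrib]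
  exact Finset.sum_congr rfl fun x _ => by rw [Real.negMulLog, neg_mul]

theorem shannon_eq_neg_sum (l : StdSimplex ℝ α) :
    shannon l = -∑ x ∈ l.weights.support, l.weights x * Real.log (l.weights x) := by
  rw [shannon, ← Finset.sum_neg_distrib]
  exact Finset.sum_congr rfl fun x _ => by rw [Real.negMulLog, neg_mul]

theorem weights_le_map (l : StdSimplex ℝ α) (f : α → β) {x : α} (hx : x ∈ l.weights.support) :
    l.weights x ≤ (l.map f).weights (f x) := by
  classical
  rw [weights_map_eq]
  exact Finset.single_le_sum (f := fun x => l.weights x) (fun a _ => l.nonneg a)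
    (Finset.mem_filter.2 ⟨hx, rfl⟩)

/-- Merging points can only raise the weight inside the logarithm. -/
theorem shannon_map_le (l : StdSimplex ℝ α) (f : α → β) : shannon (l.map f) ≤ shannon l := by
  rw [shannon_map, shannon_eq_neg_sum]
  refine neg_le_neg (Finset.sum_le_sum fun x hx => ?_)
  exact mul_le_mul_of_nonneg_left
    (Real.log_le_log (weights_pos l hx) (weights_le_map l f hx)) (l.nonneg x)

/-- Submodularity of Shannon entropy. -/
theorem shannon_submodular (l : StdSimplex ℝ α) (f : α → β) (g : α → γ) (r : β → δ) (s : γ → δ)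
    (hinj : Set.InjOn (fun x => (f x, g x)) l.weights.support)
    (hrs : ∀ x ∈ l.weights.support, r (f x) = s (g x)) :
    shannon l + shannon (l.map (r ∘ f)) ≤ shannon (l.map f) + shannon (l.map g) := by
  classical
  set P := l.map f with hP
  set Q := l.map g with hQ
  set R := l.map (r ∘ f) with hR
  have hPR : P.map r = R := by rw [hP, hR, StdSimplex.map_comp]
  have hQR : Q.map s = R := by
    rw [hQ, hR, ← StdSimplex.map_comp]
    exact map_congr _ fun x hx => (hrs x hx).symm
  -- Each summand is the weight at `(f x, g x)` of the coupling of `P` and `Q` that is conditionally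
  -- independent over `R`. That coupling has total mass 1 on `S`, and injectivity of `(f, g)` makes
  -- the sum over the support of `l` a part of it.
  have key : ∑ x ∈ l.weights.support, P.weights (f x) * Q.weights (g x) / R.weights (r (f x))
      ≤ 1 := by
    set F : β × γ → ℝ := fun z => P.weights z.1 * Q.weights z.2 / R.weights (r z.1) with hF
    set S : Finset (β × γ) :=
      (P.weights.support ×ˢ Q.weights.support).filter fun z => s z.2 = r z.1 with hS
    have h1 : ∑ x ∈ l.weights.support, F (f x, g x) =
        ∑ z ∈ l.weights.support.image fun x => (f x, g x), F z :=
      (Finset.sum_image hinj).symm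
    have h2 : ∑ z ∈ l.weights.support.image fun x => (f x, g x), F z ≤ ∑ z ∈ S, F z := by
      refine Finset.sum_le_sum_of_subset_of_nonneg ?_ fun z _ _ =>
        div_nonneg (mul_nonneg (P.nonneg _) (Q.nonneg _)) (R.nonneg _)
      intro z hz
      obtain ⟨x, hx, rfl⟩ := Finset.mem_image.1 hz
      exact Finset.mem_filter.2 ⟨Finset.mem_product.2 ⟨map_mem_support l f hx,
        map_mem_support l g hx⟩, (hrs x hx).symm⟩
    have h3 : ∑ z ∈ S, F z = 1 := by
      rw [hS, Finset.sum_filter, Finset.sum_product, ← sum_weights P]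
      refine Finset.sum_congr rfl fun y hy => ?_
      have hpos : R.weights (r y) ≠ 0 := by
        have := map_mem_support P r hy
        rw [hPR] at this
        exact Finsupp.mem_support_iff.1 this
      rw [← Finset.sum_filter]
      have : ∀ z ∈ Q.weights.support.filter (fun z => s z = r y),
          F (y, z) = P.weights y / R.weights (r y) * Q.weights z := fun z _ => by
        simp only [hF]; ring
      have hR : ∑ z ∈ Q.weights.support with s z = r y, Q.weights z = R.weights (r y) := by
        rw [← hQR, weights_map_eq]
      rw [Finset.sum_congr rfl this, ← Finset.mul_sum, hR, div_mul_cancel₀ _ hpos]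
    exact (h1.trans_le h2).trans_eq h3
  have hterm : ∀ x ∈ l.weights.support,
      l.weights x * Real.log (P.weights (f x)) + l.weights x * Real.log (Q.weights (g x))
        - l.weights x * Real.log (R.weights (r (f x))) - l.weights x * Real.log (l.weights x) ≤
      P.weights (f x) * Q.weights (g x) / R.weights (r (f x)) - l.weights x := by
    intro x hx
    have h0 := weights_pos l hx
    have hp := weights_pos P (map_mem_support l f hx)
    have hq := weights_pos Q (map_mem_support l g hx)
    have hr := weights_pos R (map_mem_support l (r ∘ f) hx)
    simp only [Function.comp] at hr
    -- Averaged over `l`, this is the nonnegativity of the relative entropy of `l` with respect to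
    -- the conditionally independent coupling.
    have hlog := Real.log_le_sub_one_of_pos
      (show 0 < P.weights (f x) * Q.weights (g x) / R.weights (r (f x)) / l.weights x by positivity)
    rw [Real.log_div (by positivity) h0.ne', Real.log_div (by positivity) hr.ne',
      Real.log_mul hp.ne' hq.ne'] at hlog
    have h4 := mul_le_mul_of_nonneg_left hlog h0.le
    have h5 : l.weights x *
        (P.weights (f x) * Q.weights (g x) / R.weights (r (f x)) / l.weights x - 1) =
        P.weights (f x) * Q.weights (g x) / R.weights (r (f x)) - l.weights x := by
      field_simp
    rw [h5] at h4
    linarith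
  have hsum := Finset.sum_le_sum hterm
  simp only [Finset.sum_sub_distrib, Finset.sum_add_distrib] at hsum
  rw [sum_weights l] at hsum
  have e1 := shannon_map l f
  have e2 := shannon_map l g
  have e3 := shannon_map l (r ∘ f)
  have e4 := shannon_eq_neg_sum l
  rw [← hP] at e1
  rw [← hQ] at e2
  rw [← hR] at e3
  simp only [Function.comp] at e3
  linarith

/-- Submodularity over a one-point space. -/
theorem shannon_le_add (l : StdSimplex ℝ α) (f : α → β) (g : α → γ)
    (hinj : Set.InjOn (fun x => (f x, g x)) l.weights.support) :
    shannon l ≤ shannon (l.map f) + shannon (l.map g) := by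
  have h := shannon_submodular l f g (fun _ => ()) (fun _ => ()) hinj fun _ _ => rfl
  linarith [shannon_nonneg (l.map ((fun _ => ()) ∘ f))]

theorem map_equiv (l : StdSimplex ℝ α) (m : StdSimplex ℝ β) (e : α ≃ β)
    (h : ∀ x, m.weights (e x) = l.weights x) : l.map e = m := by
  classical
  ext y
  obtain ⟨x, rfl⟩ := e.surjective y
  rw [weights_map_eq, h, Finset.sum_filter]
  simp only [EmbeddingLike.apply_eq_iff_eq, Finset.sum_ite_eq', Finsupp.mem_support_iff]
  split_ifs with hx
  · rfl
  · exact (not_not.1 hx).symm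

/-! ### Products -/

theorem prodDist_map_fst (l : StdSimplex ℝ α) (m : StdSimplex ℝ β) :
    (prodDist l m).map Prod.fst = l := by
  classical
  ext y
  rw [weights_map_eq]
  simp only [prodDist_weights]
  have : (prodDist l m).weights.support.filter (fun z => z.1 = y) =
      (l.weights.support.filter fun a => a = y) ×ˢ m.weights.support := by
    ext z
    simp only [Finset.mem_filter, mem_support_prodDist, Finset.mem_product]
    tauto
  rw [this, Finset.sum_product]
  simp only [← Finset.mul_sum, sum_weights, mul_one]
  rw [Finset.sum_filter, Finset.sum_ite_eq']
  split_ifs with hy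
  · rfl
  · exact (Finsupp.notMem_support_iff.1 hy).symm

theorem prodDist_map_snd (l : StdSimplex ℝ α) (m : StdSimplex ℝ β) :
    (prodDist l m).map Prod.snd = m := by
  have h : (prodDist l m).map (Equiv.prodComm α β) = prodDist m l :=
    map_equiv _ _ _ fun x => mul_comm _ _
  have h' := prodDist_map_fst m l
  rw [← h, ← StdSimplex.map_comp] at h'
  exact h'

theorem shannon_prodDist (l : StdSimplex ℝ α) (m : StdSimplex ℝ β) :
    shannon (prodDist l m) = shannon l + shannon m := by
  have hs : (prodDist l m).weights.support = l.weights.support ×ˢ m.weights.support := by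
    ext z
    rw [mem_support_prodDist, Finset.mem_product]
  rw [shannon, hs, Finset.sum_product]
  simp only [prodDist_weights, Real.negMulLog_mul, Finset.sum_add_distrib, ← Finset.mul_sum,
    ← Finset.sum_mul, sum_weights]
  rw [one_mul, one_mul]
  rfl

theorem support_piDist {K : Type*} [Fintype K] [DecidableEq K] {α : K → Type*}
    (l : ∀ k, StdSimplex ℝ (α k)) :
    (piDist l).weights.support = Fintype.piFinset fun k => (l k).weights.support := by
  ext x
  rw [mem_support_piDist, Fintype.mem_piFinset]

section Pi

variable {K : Type*} [Fintype K] {α : K → Type*} (l : ∀ k, StdSimplex ℝ (α k))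

/-- The expectation of a product of functions of independent variables. -/
theorem sum_piDist_mul_prod (φ : ∀ k, α k → ℝ) :
    ∑ x ∈ (piDist l).weights.support, (piDist l).weights x * ∏ k, φ k (x k) =
      ∏ k, ∑ a ∈ (l k).weights.support, (l k).weights a * φ k a := by
  classical
  rw [Finset.prod_univ_sum, support_piDist]
  exact Finset.sum_congr rfl fun x _ => by rw [piDist_weights, Finset.prod_mul_distrib]

theorem sum_piDist_mul_apply (k : K) (F : α k → ℝ) :
    ∑ x ∈ (piDist l).weights.support, (piDist l).weights x * F (x k) =
      ∑ a ∈ (l k).weights.support, (l k).weights a * F a := by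
  classical
  -- All factors are 1 except the one at `k`, so the other coordinates integrate to 1.
  have h := sum_piDist_mul_prod l (Function.update (fun _ _ => (1 : ℝ)) k F)
  have h1 : ∀ x : ∀ k, α k,
      ∏ j, Function.update (fun _ _ => (1 : ℝ)) k F j (x j) = F (x k) := fun x => by
    rw [Finset.prod_eq_single k (fun j _ hj => by rw [Function.update_of_ne hj])
      (fun h => absurd (Finset.mem_univ k) h), Function.update_self]
  simp only [h1] at h
  rw [h, Finset.prod_eq_single k _ (fun h => absurd (Finset.mem_univ k) h), Function.update_self]
  intro j _ hj
  rw [Function.update_of_ne hj]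
  simp only [mul_one, sum_weights]

theorem shannon_piDist : shannon (piDist l) = ∑ k, shannon (l k) := by
  have h : ∀ x ∈ (piDist l).weights.support, (piDist l).weights x *
      Real.log ((piDist l).weights x) =
      ∑ k, (piDist l).weights x * Real.log ((l k).weights (x k)) := fun x hx => by
    rw [piDist_weights, Real.log_prod, Finset.mul_sum]
    exact fun k _ => Finsupp.mem_support_iff.1 ((mem_support_piDist l x).1 hx k)
  rw [shannon_eq_neg_sum, Finset.sum_congr rfl h, Finset.sum_comm, ← Finset.sum_neg_distrib]
  refine Finset.sum_congr rfl fun k _ => ?_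
  rw [sum_piDist_mul_apply l k fun a => Real.log ((l k).weights a), shannon_eq_neg_sum]

/-- Marginals of independent products. -/
theorem piDist_map_comp {L : Type*} [Fintype L] (j : L → K) (hj : Function.Injective j) :
    (piDist l).map (fun x i => x (j i)) = piDist fun i => l (j i) := by
  classical
  ext y
  -- The factor at `j i` tests whether that coordinate equals `y i`. For `k` outside the range of
  -- `j` the condition is vacuous, so the factor is 1 and integrates to the total mass.
  have h := sum_piDist_mul_prod l fun k a => if ∀ i (h : j i = k), h ▸ y i = a then (1 : ℝ) else 0
  rw [weights_map_eq, piDist_weights, Finset.sum_filter]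
  have h1 : ∀ x ∈ (piDist l).weights.support,
      (if (fun i => x (j i)) = y then (piDist l).weights x else 0) =
      (piDist l).weights x *
        ∏ k, if ∀ i (h : j i = k), h ▸ y i = x k then (1 : ℝ) else 0 := by
    intro x _
    by_cases hx : (fun i => x (j i)) = y
    · subst hx
      rw [if_pos rfl, Finset.prod_eq_one, mul_one]
      intro k _
      refine if_pos ?_
      rintro i rfl
      rfl
    · obtain ⟨i, hi⟩ := Function.ne_iff.1 hx
      rw [if_neg hx, Finset.prod_eq_zero (Finset.mem_univ (j i)) (if_neg fun h => hi (h i rfl).symm),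
        mul_zero]
  rw [Finset.sum_congr rfl h1, h]
  refine (Fintype.prod_of_injective j hj _ _ (fun k hk => ?_) fun i => ?_).symm
  · have : ∀ a : α k, ∀ i (h : j i = k), h ▸ y i = a := fun a i hi => absurd ⟨i, hi⟩ hk
    exact (Finset.sum_congr rfl fun a _ => by rw [if_pos (this a), mul_one]).trans
      (sum_weights (l k))
  · have : ∀ a : α (j i), (∀ i' (h : j i' = j i), h ▸ y i' = a) ↔ y i = a := fun a =>
      ⟨fun h => h i rfl, by
        rintro rfl i' h'
        obtain rfl := hj h'
        rfl⟩
    simp only [this, mul_ite, mul_one, mul_zero, Finset.sum_ite_eq]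
    split_ifs with hy
    · rfl
    · exact Finsupp.notMem_support_iff.1 hy

end Pi

/-! ### Mixtures -/

section Mix

variable {T : Type*} [Fintype T] {α : T → Type*}

/-- The distribution of a pair `(t, x)`, where `t` has law `m` and `x` has law `q t` given `t`. -/
def mixDist (m : StdSimplex ℝ T) (q : ∀ t, StdSimplex ℝ (α t)) : StdSimplex ℝ (Σ t, α t) where
  weights := Finsupp.onFinset (Finset.univ.sigma fun t => (q t).weights.support)
    (fun z => m.weights z.1 * (q z.1).weights z.2)
    (fun z hz => by
      simp only [Finset.mem_sigma, Finset.mem_univ, true_and, Finsupp.mem_support_iff]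
      exact right_ne_zero_of_mul hz)
  nonneg := fun z => mul_nonneg (m.nonneg _) ((q z.1).nonneg _)
  total := by
    rw [Finsupp.onFinset_sum _ (fun _ => rfl), Finset.sum_sigma]
    simp only [← Finset.mul_sum]
    rw [← sum_weights_univ m]
    exact Finset.sum_congr rfl fun t _ => by rw [sum_weights, mul_one]

variable (m : StdSimplex ℝ T) (q : ∀ t, StdSimplex ℝ (α t))

theorem mixDist_weights (z : Σ t, α t) :
    (mixDist m q).weights z = m.weights z.1 * (q z.1).weights z.2 := rfl

theorem mem_support_mixDist (z : Σ t, α t) : z ∈ (mixDist m q).weights.support ↔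
    z.1 ∈ m.weights.support ∧ z.2 ∈ (q z.1).weights.support := by
  simp only [Finsupp.mem_support_iff, mixDist_weights, mul_ne_zero_iff]

theorem support_mixDist : (mixDist m q).weights.support =
    m.weights.support.sigma fun t => (q t).weights.support := by
  ext z
  rw [mem_support_mixDist, Finset.mem_sigma]

/-- Law of total probability. -/
theorem weights_mixDist_map (f : ∀ t, α t → β) (y : β) :
    ((mixDist m q).map fun z => f z.1 z.2).weights y =
      ∑ t, m.weights t * ((q t).map (f t)).weights y := by
  classical
  rw [weights_map_eq, Finset.sum_filter, support_mixDist, Finset.sum_sigma]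
  refine Finset.sum_subset_zero_on_sdiff (Finset.subset_univ _) (fun t ht => ?_) fun t _ => ?_
  · rw [Finsupp.notMem_support_iff.1 (Finset.mem_sdiff.1 ht).2, zero_mul]
  · rw [weights_map_eq, Finset.sum_filter, Finset.mul_sum]
    simp only [mul_ite, mul_zero]
    rfl

theorem mixDist_map {β : T → Type*} (f : ∀ t, α t → β t) :
    (mixDist m q).map (fun z => (⟨z.1, f z.1 z.2⟩ : Σ t, β t)) =
      mixDist m fun t => (q t).map (f t) := by
  classical
  ext y
  obtain ⟨s, y⟩ := y
  rw [weights_mixDist_map m q (fun t x => (⟨t, f t x⟩ : Σ t, β t)),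
    Finset.sum_eq_single s _ (fun h => absurd (Finset.mem_univ s) h), mixDist_weights,
    weights_map_eq, weights_map_eq]
  · simp only [Sigma.mk.injEq, heq_eq_eq, true_and]
  · intro t _ ht
    rw [weights_map_eq, Finset.sum_filter]
    simp [ht]

theorem mixDist_map_of_forall {b : StdSimplex ℝ β} {f : ∀ t, α t → β}
    (h : ∀ t, (q t).map (f t) = b) : (mixDist m q).map (fun z => f z.1 z.2) = b := by
  ext y
  simp only [weights_mixDist_map, h]
  rw [← Finset.sum_mul, sum_weights_univ, one_mul]

theorem mixDist_map_fst : (mixDist m q).map Sigma.fst = m := by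
  classical
  ext s
  rw [weights_mixDist_map m q fun t _ => t, Finset.sum_eq_single s]
  · rw [weights_map_eq, Finset.filter_true_of_mem fun _ _ => rfl, sum_weights, mul_one]
  · intro t _ ht
    rw [weights_map_eq, Finset.filter_false_of_mem fun _ _ => ht, Finset.sum_empty, mul_zero]
  · exact fun h => absurd (Finset.mem_univ s) h

/-- Chain rule for entropy, from the product rule for `negMulLog`. -/
theorem shannon_mixDist :
    shannon (mixDist m q) = shannon m + ∑ t, m.weights t * shannon (q t) := by
  have h : ∑ t, m.weights t * shannon (q t) = ∑ t ∈ m.weights.support, m.weights t * shannon (q t) :=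
    (Finset.sum_subset (Finset.subset_univ _) fun t _ ht => by
      rw [Finsupp.notMem_support_iff.1 ht, zero_mul]).symm
  rw [h, shannon, support_mixDist, Finset.sum_sigma]
  simp only [mixDist_weights, Real.negMulLog_mul, Finset.sum_add_distrib, ← Finset.mul_sum,
    ← Finset.sum_mul]
  refine congrArg₂ _ (Finset.sum_congr rfl fun t _ => ?_) rfl
  rw [sum_weights, one_mul]

end Mix

/-! ### Conditionally independent couplings -/

/-- The law of a pair with given marginals that is conditionally independent over a common image
of the two components. -/
def coupling (l : StdSimplex ℝ α) (m : StdSimplex ℝ β) (g : α → γ) (h : β → γ)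
    (e : l.map g = m.map h) : StdSimplex ℝ (α × β) where
  weights := by
    classical
    exact Finsupp.onFinset (l.weights.support ×ˢ m.weights.support)
      (fun z => if g z.1 = h z.2 then
        l.weights z.1 * m.weights z.2 / (l.map g).weights (g z.1) else 0)
      (fun z hz => by
        simp only [Finset.mem_product, Finsupp.mem_support_iff]
        constructor <;> intro h0 <;> simp [h0] at hz)
  nonneg := fun z => by
    simp only [Finsupp.onFinset_apply]
    split_ifs
    · exact div_nonneg (mul_nonneg (l.nonneg _) (m.nonneg _)) ((l.map g).nonneg _)
    · exact le_rfl
  total := by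
    classical
    rw [Finsupp.onFinset_sum _ (fun _ => rfl), Finset.sum_product, ← sum_weights l]
    refine Finset.sum_congr rfl fun a ha => ?_
    have hpos := weights_pos _ (map_mem_support l g ha)
    rw [← Finset.sum_filter]
    simp only
    rw [← Finset.sum_div, ← Finset.mul_sum]
    have : ∑ b ∈ m.weights.support with g a = h b, m.weights b = (l.map g).weights (g a) := by
      rw [e, weights_map_eq]
      simp only [eq_comm]
    rw [this, mul_div_cancel_right₀ _ hpos.ne']

section Coupling

variable (l : StdSimplex ℝ α) (m : StdSimplex ℝ β) (g : α → γ) (h : β → γ)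
  (e : l.map g = m.map h)

theorem coupling_weights [DecidableEq γ] (z : α × β) : (coupling l m g h e).weights z =
    if g z.1 = h z.2 then l.weights z.1 * m.weights z.2 / (l.map g).weights (g z.1) else 0 := by
  simp only [coupling, Finsupp.onFinset_apply]
  congr

theorem eq_of_mem_support_coupling {z : α × β} (hz : z ∈ (coupling l m g h e).weights.support) :
    g z.1 = h z.2 := by
  classical
  rw [Finsupp.mem_support_iff, coupling_weights] at hz
  exact (ite_ne_right_iff.1 hz).1

theorem coupling_map_fst : (coupling l m g h e).map Prod.fst = l := by
  classical
  ext a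
  have hsub : (coupling l m g h e).weights.support ⊆ l.weights.support ×ˢ m.weights.support :=
    fun z hz => by
      rw [Finsupp.mem_support_iff, coupling_weights] at hz
      simp only [Finset.mem_product, Finsupp.mem_support_iff]
      constructor <;> intro h0 <;> simp [h0] at hz
  rw [weights_map_eq, Finset.sum_filter, Finset.sum_subset hsub, Finset.sum_product,
    Finset.sum_eq_single a]
  · by_cases ha : a ∈ l.weights.support
    · have hpos := weights_pos _ (map_mem_support l g ha)
      simp only [if_true, coupling_weights]
      rw [← Finset.sum_filter, ← Finset.sum_div, ← Finset.mul_sum]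
      have : ∑ b ∈ m.weights.support with g a = h b, m.weights b = (l.map g).weights (g a) := by
        rw [e, weights_map_eq]
        simp only [eq_comm]
      rw [this, mul_div_cancel_right₀ _ hpos.ne']
    · simp only [coupling_weights, Finsupp.notMem_support_iff.1 ha, zero_mul, zero_div,
        ite_self, Finset.sum_const_zero]
  · intro b _ hb
    exact Finset.sum_eq_zero fun c _ => if_neg hb
  · intro ha
    simp only [coupling_weights, Finsupp.notMem_support_iff.1 ha, zero_mul, zero_div,
        ite_self, Finset.sum_const_zero]
  · intro z _ hz
    rw [Finsupp.notMem_support_iff.1 hz, ite_self]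

theorem coupling_map_snd : (coupling l m g h e).map Prod.snd = m := by
  classical
  have hc : (coupling l m g h e).map (Equiv.prodComm α β) = coupling m l h g e.symm := by
    refine map_equiv _ _ _ fun z => ?_
    rw [coupling_weights, coupling_weights]
    simp only [Equiv.prodComm_apply, Prod.fst_swap, Prod.snd_swap, eq_comm (a := h z.2)]
    refine ite_congr rfl (fun hz => ?_) fun _ => rfl
    rw [mul_comm, e, hz]
  have h' := coupling_map_fst m l h g e.symm
  rw [← hc, ← StdSimplex.map_comp] at h'
  exact h'

end Coupling

end Distributions

end FinProb
/-! ## Reductions of diagrams -/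

theorem FinProb.entropy_nonneg (X : FinProb.{u}) : 0 ≤ X.entropy := FinProb.shannon_nonneg X.law

theorem FinProb.entropy_le_of_hom {X Y : FinProb.{u}} (f : X ⟶ Y) : Y.entropy ≤ X.entropy := by
  have h := FinProb.shannon_map_le X.law (FinProb.rep f).1
  rw [(FinProb.rep f).2] at h
  exact h

section Diagrams

variable {G : Type v} [Category.{w} G]

namespace Diagram

open TropicalProb.FinProb (MPMap rep)

/-- A reduction of diagrams from measure-preserving maps that are compatible, on atoms, with maps
representing the reductions inside the diagrams. -/
def homMk {X Y : Diagram.{u} G} (a : ∀ {i j : G}, (i ⟶ j) → MPMap (X.obj i) (X.obj j))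
    (b : ∀ {i j : G}, (i ⟶ j) → MPMap (Y.obj i) (Y.obj j))
    (ha : ∀ {i j : G} (φ : i ⟶ j), X.map φ = (a φ).toHom)
    (hb : ∀ {i j : G} (φ : i ⟶ j), Y.map φ = (b φ).toHom)
    (f : ∀ i, MPMap (X.obj i) (Y.obj i))
    (nat : ∀ {i j : G} (φ : i ⟶ j), ∀ x ∈ (X.obj i).law.weights.support,
      (f j).1 ((a φ).1 x) = (b φ).1 ((f i).1 x)) : X ⟶ Y where
  app i := (f i).toHom
  naturality i j φ := by
    rw [ha, hb, FinProb.toHom_comp, FinProb.toHom_comp, FinProb.toHom_eq]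
    exact nat φ

theorem rep_naturality {X Y : Diagram.{u} G} (η : X ⟶ Y) {i j : G} (φ : i ⟶ j)
    {x : (X.obj i).carrier} (hx : x ∈ (X.obj i).law.weights.support) :
    (rep (η.app j)).1 ((rep (X.map φ)).1 x) = (rep (Y.map φ)).1 ((rep (η.app i)).1 x) := by
  rw [← FinProb.rep_comp _ _ hx, ← FinProb.rep_comp _ _ hx, η.naturality]

theorem map_eq_toHom_rep (X : Diagram.{u} G) {i j : G} (φ : i ⟶ j) :
    X.map φ = (rep (X.map φ)).toHom := (FinProb.toHom_rep _).symm

/-! ### Tensor products -/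

def tensorFst (X Y : Diagram.{u} G) : X.tensor Y ⟶ X :=
  homMk (fun φ => (rep (X.map φ)).tensor (rep (Y.map φ))) (fun φ => rep (X.map φ))
    (fun _ => rfl) (fun φ => map_eq_toHom_rep X φ)
    (fun _ => ⟨Prod.fst, FinProb.prodDist_map_fst _ _⟩) (fun _ _ _ => rfl)

def tensorSnd (X Y : Diagram.{u} G) : X.tensor Y ⟶ Y :=
  homMk (fun φ => (rep (X.map φ)).tensor (rep (Y.map φ))) (fun φ => rep (Y.map φ))
    (fun _ => rfl) (fun φ => map_eq_toHom_rep Y φ)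
    (fun _ => ⟨Prod.snd, FinProb.prodDist_map_snd _ _⟩) (fun _ _ _ => rfl)

/-- The tensor product of two reductions of diagrams. -/
def tensorHom {X X' Y Y' : Diagram.{u} G} (f : X ⟶ Y) (g : X' ⟶ Y') :
    X.tensor X' ⟶ Y.tensor Y' :=
  homMk (fun φ => (rep (X.map φ)).tensor (rep (X'.map φ)))
    (fun φ => (rep (Y.map φ)).tensor (rep (Y'.map φ)))
    (fun _ => rfl) (fun _ => rfl)
    (fun i => (rep (f.app i)).tensor (rep (g.app i)))
    (fun φ x hx => by
      have hx' := (FinProb.mem_support_prodDist _ _ x).1 hx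
      exact Prod.ext (rep_naturality f φ hx'.1) (rep_naturality g φ hx'.2))

theorem entropy_tensor (X Y : Diagram.{u} G) (i : G) :
    ((X.tensor Y).obj i).entropy = (X.obj i).entropy + (Y.obj i).entropy :=
  FinProb.shannon_prodDist _ _

theorem entropy_tensorFam {K : Type w'} [Fintype K] (X : K → Diagram.{u} G) (i : G) :
    ((tensorFam X).obj i).entropy = ∑ k, ((X k).obj i).entropy :=
  FinProb.shannon_piDist _

theorem entropy_power (X : Diagram.{u} G) (n : ℕ) (i : G) :
    ((X.power n).obj i).entropy = n * (X.obj i).entropy := by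
  rw [power, entropy_tensorFam, Finset.sum_const, Finset.card_univ, Fintype.card_fin, nsmul_eq_mul]

/-- Marginalization of tensor products of families. -/
def tensorFamRestrict {K L : Type u} [Fintype K] [Fintype L] (X : K → Diagram.{u} G) (j : L → K)
    (hj : Function.Injective j) : tensorFam X ⟶ tensorFam fun l => X (j l) :=
  homMk (fun φ => MPMap.tensorFam fun k => rep ((X k).map φ))
    (fun φ => MPMap.tensorFam fun l => rep ((X (j l)).map φ)) (fun _ => rfl) (fun _ => rfl)
    (fun i => ⟨fun x l => x (j l), FinProb.piDist_map_comp (fun k => ((X k).obj i).law) j hj⟩)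
    (fun _ _ _ => rfl)

/-- A tensor power, with the index set lifted to a larger universe. -/
def tensorFamPower (X : Diagram.{u} G) (n : ℕ) :
    (tensorFam fun _ : ULift.{u} (Fin n) => X) ⟶ X.power n :=
  homMk (fun φ => MPMap.tensorFam fun _ => rep (X.map φ))
    (fun φ => MPMap.tensorFam fun _ => rep (X.map φ)) (fun _ => rfl) (fun _ => rfl)
    (fun i => ⟨fun x k => x ⟨k⟩, FinProb.piDist_map_comp (K := ULift.{u} (Fin n))
      (fun _ => (X.obj i).law) ULift.up ULift.up_injective⟩)
    (fun _ _ _ => rfl)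

/-- A bijection on points, hence entropy-preserving. Such reductions serve in place of isomorphisms,
since they force distance zero. -/
def tensorFamSum {K L : Type u} [Fintype K] [Fintype L] (X : K ⊕ L → Diagram.{u} G) :
    tensorFam X ⟶ (tensorFam fun k => X (Sum.inl k)).tensor (tensorFam fun l => X (Sum.inr l)) :=
  homMk (fun φ => MPMap.tensorFam fun k => rep ((X k).map φ))
    (fun φ => (rep _).tensor (rep _)) (fun _ => rfl) (fun _ => rfl)
    (fun i => ⟨Equiv.sumPiEquivProdPi fun k => ((X k).obj i).carrier,
      FinProb.map_equiv _ _ _ fun x => (Fintype.prod_sum_type fun k => ((X k).obj i).law.weights (x k)).symm⟩)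
    (fun φ x hx => by
      have hx' := (FinProb.mem_support_piDist _ x).1 hx
      -- The representative chosen for a map of a tensor diagram agrees with the coordinatewise map
      -- only on atoms, so membership in the support is needed in each factor.
      refine Prod.ext ?_ ?_
      · exact (FinProb.toHom_eq.1 (FinProb.toHom_rep
          ((tensorFam fun k => X (Sum.inl k)).map φ)) _
          ((FinProb.mem_support_piDist _ _).2 fun k => hx' (Sum.inl k))).symm
      · exact (FinProb.toHom_eq.1 (FinProb.toHom_rep
          ((tensorFam fun k => X (Sum.inr k)).map φ)) _
          ((FinProb.mem_support_piDist _ _).2 fun k => hx' (Sum.inr k))).symm)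

def tensorFamSigma {U : Type u} [Fintype U] (D : U → Diagram.{u} G) (n : U → ℕ) :
    (tensorFam fun s : Σ a, Fin (n a) => D s.1) ⟶ tensorFam fun a => (D a).power (n a) :=
  homMk (fun φ => MPMap.tensorFam fun s => rep ((D s.1).map φ))
    (fun φ => MPMap.tensorFam fun a => rep (((D a).power (n a)).map φ)) (fun _ => rfl)
    (fun _ => rfl)
    (fun i => ⟨Equiv.piCurry fun (a : U) (_ : Fin (n a)) => ((D a).obj i).carrier,
      FinProb.map_equiv _ _ _ fun x =>
        (Fintype.prod_sigma fun s : Σ a, Fin (n a) => ((D s.1).obj i).law.weights (x s)).symm⟩)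
    (fun φ x hx => by
      have hx' := (FinProb.mem_support_piDist _ x).1 hx
      funext a
      exact (FinProb.toHom_eq.1 (FinProb.toHom_rep (((D a).power (n a)).map φ)) _
          ((FinProb.mem_support_piDist _ _).2 fun k => hx' ⟨a, k⟩)).symm)

/-! ### Mixtures of diagrams -/

section Mix

variable {T : Type u} [Fintype T] (m : StdSimplex ℝ T)

/-- The mixture of a family of diagrams. -/
def mix (D : T → Diagram.{u} G) : Diagram.{u} G where
  obj i := ⟨Σ t, ((D t).obj i).carrier, FinProb.mixDist m fun t => ((D t).obj i).law⟩
  map φ := MPMap.toHom ⟨fun z => ⟨z.1, (rep ((D z.1).map φ)).1 z.2⟩, by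
    rw [FinProb.mixDist_map m _ fun t => (rep ((D t).map φ)).1]
    exact congrArg _ (funext fun t => (rep ((D t).map φ)).2)⟩
  map_id i := by
    rw [FinProb.toHom_id, FinProb.toHom_eq]
    intro z hz
    have h := FinProb.rep_id ((FinProb.mem_support_mixDist _ _ z).1 hz).2
    rw [← (D z.1).map_id] at h
    exact Sigma.ext rfl (heq_of_eq h)
  map_comp f g := by
    rw [FinProb.toHom_comp, FinProb.toHom_eq]
    intro z hz
    have h := FinProb.rep_comp ((D z.1).map f) ((D z.1).map g)
      ((FinProb.mem_support_mixDist _ _ z).1 hz).2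
    rw [← (D z.1).map_comp] at h
    exact Sigma.ext rfl (heq_of_eq h)

def mixMap {D D' : T → Diagram.{u} G} (f : ∀ t, D t ⟶ D' t) : mix m D ⟶ mix m D' :=
  homMk (fun φ => ⟨fun z => ⟨z.1, (rep ((D z.1).map φ)).1 z.2⟩, _⟩)
    (fun φ => ⟨fun z => ⟨z.1, (rep ((D' z.1).map φ)).1 z.2⟩, _⟩) (fun _ => rfl) (fun _ => rfl)
    (fun i => ⟨fun z => ⟨z.1, (rep ((f z.1).app i)).1 z.2⟩, by
      refine (FinProb.mixDist_map m _ fun t => (rep ((f t).app i)).1).trans ?_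
      exact congrArg _ (funext fun t => (rep ((f t).app i)).2)⟩)
    (fun φ z hz => Sigma.ext rfl (heq_of_eq
      (rep_naturality (f z.1) φ ((FinProb.mem_support_mixDist _ _ z).1 hz).2)))

/-- Unlike `mixMap`, this forgets the index `t`; it is the leg on which the entropy of `m` is lost.
-/
def mixDesc {D : T → Diagram.{u} G} {Y : Diagram.{u} G} (f : ∀ t, D t ⟶ Y) : mix m D ⟶ Y :=
  homMk (fun φ => ⟨fun z => ⟨z.1, (rep ((D z.1).map φ)).1 z.2⟩, _⟩)
    (fun φ => rep (Y.map φ)) (fun _ => rfl) (fun φ => map_eq_toHom_rep Y φ)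
    (fun i => ⟨fun z => (rep ((f z.1).app i)).1 z.2,
      FinProb.mixDist_map_of_forall m _ fun t => (rep ((f t).app i)).2⟩)
    (fun φ z hz => rep_naturality (f z.1) φ ((FinProb.mem_support_mixDist _ _ z).1 hz).2)

theorem entropy_mix (D : T → Diagram.{u} G) (i : G) : ((mix m D).obj i).entropy =
    FinProb.shannon m + ∑ t, m.weights t * ((D t).obj i).entropy :=
  FinProb.shannon_mixDist m _

end Mix

/-! ### Amalgams -/

section Amalgam

variable [Fintype G] [IndexingCategory G] [Nonempty G] {Z W Y : Diagram.{u} G} (f : Z ⟶ Y)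
  (g : W ⟶ Y)

/-- The coupling of the initial spaces of `Z` and `W` that is independent over that of `Y`. -/
def amalgamInitial : StdSimplex ℝ
    ((Z.obj (initialObj G)).carrier × (W.obj (initialObj G)).carrier) :=
  FinProb.coupling (Z.obj _).law (W.obj _).law (rep (f.app (initialObj G))).1
    (rep (g.app (initialObj G))).1 ((rep (f.app _)).2.trans (rep (g.app _)).2.symm)

/-- Pushing forward from the initial space makes these laws compatible with all maps. Away from the
initial object the result need not be conditionally independent; it is only a coupling concentrated
on the fibre product over `Y_i`, which is all that submodularity requires. -/
def amalgamLaw (i : G) : StdSimplex ℝ ((Z.obj i).carrier × (W.obj i).carrier) :=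
  (amalgamInitial f g).map fun z =>
    ((rep (Z.map (fromInitial i))).1 z.1, (rep (W.map (fromInitial i))).1 z.2)

theorem fst_mem_of_amalgamInitial {z} (hz : z ∈ (amalgamInitial f g).weights.support) :
    z.1 ∈ (Z.obj (initialObj G)).law.weights.support := by
  have h := FinProb.map_mem_support (amalgamInitial f g) Prod.fst hz
  rwa [amalgamInitial, FinProb.coupling_map_fst] at h

theorem snd_mem_of_amalgamInitial {z} (hz : z ∈ (amalgamInitial f g).weights.support) :
    z.2 ∈ (W.obj (initialObj G)).law.weights.support := by
  have h := FinProb.map_mem_support (amalgamInitial f g) Prod.snd hz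
  rwa [amalgamInitial, FinProb.coupling_map_snd] at h

theorem amalgamLaw_map_fst (i : G) : (amalgamLaw f g i).map Prod.fst = (Z.obj i).law := by
  have h : (amalgamLaw f g i).map Prod.fst =
      ((amalgamInitial f g).map Prod.fst).map (rep (Z.map (fromInitial i))).1 := by
    rw [amalgamLaw, StdSimplex.map_map, StdSimplex.map_map]
  rw [h, amalgamInitial, FinProb.coupling_map_fst]
  exact (rep (Z.map (fromInitial i))).2

theorem amalgamLaw_map_snd (i : G) : (amalgamLaw f g i).map Prod.snd = (W.obj i).law := by
  have h : (amalgamLaw f g i).map Prod.snd =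
      ((amalgamInitial f g).map Prod.snd).map (rep (W.map (fromInitial i))).1 := by
    rw [amalgamLaw, StdSimplex.map_map, StdSimplex.map_map]
  rw [h, amalgamInitial, FinProb.coupling_map_snd]
  exact (rep (W.map (fromInitial i))).2

theorem fst_mem_of_amalgamLaw {i : G} {z} (hz : z ∈ (amalgamLaw f g i).weights.support) :
    z.1 ∈ (Z.obj i).law.weights.support := by
  have h := FinProb.map_mem_support _ Prod.fst hz
  rwa [amalgamLaw_map_fst] at h

theorem snd_mem_of_amalgamLaw {i : G} {z} (hz : z ∈ (amalgamLaw f g i).weights.support) :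
    z.2 ∈ (W.obj i).law.weights.support := by
  have h := FinProb.map_mem_support _ Prod.snd hz
  rwa [amalgamLaw_map_snd] at h

/-- The equality holds on the initial space by the choice of the coupling, and naturality of `f` and
`g` carries it to `i`. -/
theorem eq_of_mem_amalgamLaw {i : G} {z} (hz : z ∈ (amalgamLaw f g i).weights.support) :
    (rep (f.app i)).1 z.1 = (rep (g.app i)).1 z.2 := by
  obtain ⟨y, hy, rfl⟩ := FinProb.exists_of_mem_support_map _ _ hz
  rw [rep_naturality f _ (fst_mem_of_amalgamInitial f g hy),
    rep_naturality g _ (snd_mem_of_amalgamInitial f g hy),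
    FinProb.eq_of_mem_support_coupling _ _ _ _ _ hy]

theorem rep_map_fromInitial (X : Diagram.{u} G) {i j : G} (φ : i ⟶ j)
    {x : (X.obj (initialObj G)).carrier} (hx : x ∈ (X.obj (initialObj G)).law.weights.support) :
    (rep (X.map φ)).1 ((rep (X.map (fromInitial i))).1 x) =
      (rep (X.map (fromInitial j))).1 x := by
  rw [← FinProb.rep_comp _ _ hx, ← X.map_comp,
    (IndexingCategory.thin (initialObj G) j).elim (fromInitial i ≫ φ) (fromInitial j)]

theorem amalgamLaw_map {i j : G} (φ : i ⟶ j) :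
    (amalgamLaw f g i).map (fun z => ((rep (Z.map φ)).1 z.1, (rep (W.map φ)).1 z.2)) =
      amalgamLaw f g j := by
  rw [amalgamLaw, amalgamLaw, StdSimplex.map_map]
  exact FinProb.map_congr _ fun z hz => Prod.ext
    (rep_map_fromInitial Z φ (fst_mem_of_amalgamInitial f g hz))
    (rep_map_fromInitial W φ (snd_mem_of_amalgamInitial f g hz))

/-- The amalgam of two diagrams over a third. -/
def amalgam : Diagram.{u} G where
  obj i := ⟨(Z.obj i).carrier × (W.obj i).carrier, amalgamLaw f g i⟩
  map φ := MPMap.toHom ⟨fun z => ((rep (Z.map φ)).1 z.1, (rep (W.map φ)).1 z.2),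
    amalgamLaw_map f g φ⟩
  map_id i := by
    rw [FinProb.toHom_id, FinProb.toHom_eq]
    intro z hz
    have h := FinProb.rep_id (fst_mem_of_amalgamLaw f g hz)
    have h' := FinProb.rep_id (snd_mem_of_amalgamLaw f g hz)
    rw [← Z.map_id] at h
    rw [← W.map_id] at h'
    exact Prod.ext h h'
  map_comp a b := by
    rw [FinProb.toHom_comp, FinProb.toHom_eq]
    intro z hz
    have h := FinProb.rep_comp (Z.map a) (Z.map b) (fst_mem_of_amalgamLaw f g hz)
    have h' := FinProb.rep_comp (W.map a) (W.map b) (snd_mem_of_amalgamLaw f g hz)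
    rw [← Z.map_comp] at h
    rw [← W.map_comp] at h'
    exact Prod.ext h h'

def amalgamFst : amalgam f g ⟶ Z :=
  homMk (fun φ => ⟨fun z => ((rep (Z.map φ)).1 z.1, (rep (W.map φ)).1 z.2),
      amalgamLaw_map f g φ⟩) (fun φ => rep (Z.map φ))
    (fun _ => rfl) (fun φ => map_eq_toHom_rep Z φ)
    (fun i => ⟨Prod.fst, amalgamLaw_map_fst f g i⟩) (fun _ _ _ => rfl)

def amalgamSnd : amalgam f g ⟶ W :=
  homMk (fun φ => ⟨fun z => ((rep (Z.map φ)).1 z.1, (rep (W.map φ)).1 z.2),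
      amalgamLaw_map f g φ⟩) (fun φ => rep (W.map φ))
    (fun _ => rfl) (fun φ => map_eq_toHom_rep W φ)
    (fun i => ⟨Prod.snd, amalgamLaw_map_snd f g i⟩) (fun _ _ _ => rfl)

/-- Submodularity for the two projections, which are jointly injective and have `Y_i` as a common
image. -/
theorem entropy_amalgam_le (i : G) : ((amalgam f g).obj i).entropy + (Y.obj i).entropy ≤
    (Z.obj i).entropy + (W.obj i).entropy := by
  have h := FinProb.shannon_submodular (amalgamLaw f g i) Prod.fst Prod.snd (rep (f.app i)).1
    (rep (g.app i)).1 (fun x _ y _ h => h) fun z hz => eq_of_mem_amalgamLaw f g hz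
  rw [StdSimplex.map_comp, amalgamLaw_map_fst, amalgamLaw_map_snd, (rep (f.app i)).2] at h
  exact h

end Amalgam

/-! ### The intrinsic entropy distance -/

section Distance

variable [Fintype G]

theorem entropyL1_eq_of_hom {X Y : Diagram.{u} G} (f : X ⟶ Y) :
    entropyL1 X Y = ∑ i, ((X.obj i).entropy - (Y.obj i).entropy) :=
  Finset.sum_congr rfl fun i _ => abs_of_nonneg (sub_nonneg.2 (FinProb.entropy_le_of_hom (f.app i)))

/-- Reductions do not increase entropy, so the absolute values open and the cost of a fan becomes
linear in the entropies. -/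
theorem Fan.kd_eq {X Y : Diagram.{u} G} (K : Fan X Y) : K.kd =
    ∑ i, (2 * (K.top.obj i).entropy - (X.obj i).entropy - (Y.obj i).entropy) := by
  rw [Fan.kd, entropyL1_eq_of_hom K.left, entropyL1_eq_of_hom K.right, ← Finset.sum_add_distrib]
  exact Finset.sum_congr rfl fun i _ => by ring

theorem Fan.kd_nonneg {X Y : Diagram.{u} G} (K : Fan X Y) : 0 ≤ K.kd :=
  add_nonneg (Finset.sum_nonneg fun _ _ => abs_nonneg _) (Finset.sum_nonneg fun _ _ => abs_nonneg _)

theorem bddBelow_kd (X Y : Diagram.{u} G) : BddBelow (Set.range fun K : Fan X Y => K.kd) :=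
  ⟨0, by rintro _ ⟨K, rfl⟩; exact K.kd_nonneg⟩

instance (X Y : Diagram.{u} G) : Nonempty (Fan X Y) :=
  ⟨⟨X.tensor Y, tensorFst X Y, tensorSnd X Y⟩⟩

theorem ikd_nonneg (X Y : Diagram.{u} G) : 0 ≤ ikd X Y := Real.iInf_nonneg Fan.kd_nonneg

theorem ikd_le_kd {X Y : Diagram.{u} G} (K : Fan X Y) : ikd X Y ≤ K.kd :=
  ciInf_le (bddBelow_kd X Y) K

theorem exists_kd_lt (X Y : Diagram.{u} G) {ε : ℝ} (hε : 0 < ε) :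
    ∃ K : Fan X Y, K.kd < ikd X Y + ε :=
  exists_lt_of_ciInf_lt (lt_add_of_pos_right _ hε)

theorem le_ikd {X Y : Diagram.{u} G} {c : ℝ} (h : ∀ K : Fan X Y, c ≤ K.kd) : c ≤ ikd X Y :=
  le_ciInf h

theorem ikd_comm (X Y : Diagram.{u} G) : ikd X Y = ikd Y X := by
  have h : ∀ X Y : Diagram.{u} G, ikd X Y ≤ ikd Y X := fun X Y => le_ikd fun K =>
    (ikd_le_kd ⟨K.top, K.right, K.left⟩).trans_eq (add_comm _ _)
  exact le_antisymm (h X Y) (h Y X)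

theorem ikd_le_of_hom {X Y : Diagram.{u} G} (f : X ⟶ Y) :
    ikd X Y ≤ ∑ i, ((X.obj i).entropy - (Y.obj i).entropy) := by
  refine (ikd_le_kd ⟨X, 𝟙 X, f⟩).trans_eq ?_
  rw [Fan.kd_eq]
  exact Finset.sum_congr rfl fun i _ => by ring

/-- This replaces the use of isomorphisms: diagrams at distance zero are interchangeable in all
later estimates. -/
theorem ikd_eq_zero_of_hom {X Y : Diagram.{u} G} (f : X ⟶ Y)
    (h : ∀ i, (X.obj i).entropy = (Y.obj i).entropy) : ikd X Y = 0 := by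
  refine le_antisymm ((ikd_le_of_hom f).trans_eq ?_) (ikd_nonneg X Y)
  exact Finset.sum_eq_zero fun i _ => sub_eq_zero.2 (h i)

theorem ikd_self (X : Diagram.{u} G) : ikd X X = 0 := ikd_eq_zero_of_hom (𝟙 X) fun _ => rfl

/-- Tensor two near-optimal fans; entropies add. -/
theorem ikd_tensor_le (X X' Y Y' : Diagram.{u} G) :
    ikd (X.tensor X') (Y.tensor Y') ≤ ikd X Y + ikd X' Y' := by
  refine le_of_forall_pos_le_add fun ε hε => ?_
  obtain ⟨K, hK⟩ := exists_kd_lt X Y (half_pos hε)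
  obtain ⟨K', hK'⟩ := exists_kd_lt X' Y' (half_pos hε)
  have h := ikd_le_kd (⟨K.top.tensor K'.top, tensorHom K.left K'.left,
    tensorHom K.right K'.right⟩ : Fan (X.tensor X') (Y.tensor Y'))
  have e : Fan.kd (⟨K.top.tensor K'.top, tensorHom K.left K'.left,
      tensorHom K.right K'.right⟩ : Fan (X.tensor X') (Y.tensor Y')) = K.kd + K'.kd := by
    rw [Fan.kd_eq, Fan.kd_eq, Fan.kd_eq, ← Finset.sum_add_distrib]
    exact Finset.sum_congr rfl fun i _ => by simp only [entropy_tensor]; ring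
  linarith

/-- Two near-optimal fans meeting at `Y` are composed by amalgamating their tops over `Y`. -/
theorem ikd_triangle [IndexingCategory G] [Nonempty G] (X Y Z : Diagram.{u} G) :
    ikd X Z ≤ ikd X Y + ikd Y Z := by
  refine le_of_forall_pos_le_add fun ε hε => ?_
  obtain ⟨K, hK⟩ := exists_kd_lt X Y (half_pos hε)
  obtain ⟨L, hL⟩ := exists_kd_lt Y Z (half_pos hε)
  have h := ikd_le_kd (⟨amalgam K.right L.left, amalgamFst K.right L.left ≫ K.left,
    amalgamSnd K.right L.left ≫ L.right⟩ : Fan X Z)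
  have e : Fan.kd (⟨amalgam K.right L.left, amalgamFst K.right L.left ≫ K.left,
      amalgamSnd K.right L.left ≫ L.right⟩ : Fan X Z) ≤ K.kd + L.kd := by
    rw [Fan.kd_eq, Fan.kd_eq, Fan.kd_eq, ← Finset.sum_add_distrib]
    refine Finset.sum_le_sum fun i _ => ?_
    have := entropy_amalgam_le K.right L.left i
    linarith
  linarith

/-- The distance to a mixture exceeds the mean distance by at most the entropy of the mixing law
on each space. -/
theorem ikd_mix_le {T : Type u} [Fintype T] (m : StdSimplex ℝ T) (D : T → Diagram.{u} G)
    (Y : Diagram.{u} G) : ikd (mix m D) Y ≤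
      Fintype.card G * FinProb.shannon m + ∑ t, m.weights t * ikd (D t) Y := by
  refine le_of_forall_pos_le_add fun ε hε => ?_
  choose K hK using fun t => exists_kd_lt (D t) Y hε
  have h := ikd_le_kd (⟨mix m fun t => (K t).top, mixMap m fun t => (K t).left,
    mixDesc m fun t => (K t).right⟩ : Fan (mix m D) Y)
  -- Each top has entropy `shannon m` plus the mean of the component tops. Of the two copies of
  -- `shannon m`, one is cancelled by the left foot, itself a mixture over `m`; the other survives
  -- on every space.
  have e : Fan.kd (⟨mix m fun t => (K t).top, mixMap m fun t => (K t).left,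
      mixDesc m fun t => (K t).right⟩ : Fan (mix m D) Y) =
      Fintype.card G * FinProb.shannon m + ∑ t, m.weights t * (K t).kd := by
    simp only [Fan.kd_eq, Finset.mul_sum]
    rw [Finset.sum_comm, ← Finset.card_univ, ← nsmul_eq_mul, ← Finset.sum_const,
      ← Finset.sum_add_distrib]
    refine Finset.sum_congr rfl fun i _ => ?_
    have hY : (Y.obj i).entropy = ∑ t, m.weights t * (Y.obj i).entropy := by
      rw [← Finset.sum_mul, FinProb.sum_weights_univ, one_mul]
    rw [entropy_mix, entropy_mix]
    simp only [mul_sub, Finset.sum_sub_distrib, mul_left_comm _ (2 : ℝ), ← Finset.mul_sum]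
    rw [← hY]
    ring
  have e' : ∑ t, m.weights t * (K t).kd ≤ ∑ t, m.weights t * ikd (D t) Y + ε := by
    have : ∑ t, m.weights t * (ikd (D t) Y + ε) = ∑ t, m.weights t * ikd (D t) Y + ε := by
      simp only [mul_add, Finset.sum_add_distrib, ← Finset.sum_mul, FinProb.sum_weights_univ,
        one_mul]
    rw [← this]
    exact Finset.sum_le_sum fun t _ => mul_le_mul_of_nonneg_left (hK t).le (m.nonneg t)
  linarith

end Distance

end Diagram
end Diagrams
/-! ## Counts in random words -/

namespace FinProb

section Words

variable {T : Type*} [Fintype T] {K : Type*} [Fintype K]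

theorem sum_support_eq_sum_univ {α : Type*} [Fintype α] (l : StdSimplex ℝ α) (F : α → ℝ) :
    ∑ x ∈ l.weights.support, l.weights x * F x = ∑ x, l.weights x * F x :=
  Finset.sum_subset (Finset.subset_univ _) fun x _ hx => by
    rw [Finsupp.notMem_support_iff.1 hx, zero_mul]

/-- The second moment of a sum of independent centred variables bounded by `1`. -/
theorem sum_piDist_mul_sq_le [DecidableEq K] (l : StdSimplex ℝ T) (g : T → ℝ)
    (h0 : ∑ t, l.weights t * g t = 0) (h1 : ∀ t, |g t| ≤ 1) :
    ∑ e, (piDist fun _ : K => l).weights e * (∑ k, g (e k)) ^ 2 ≤ Fintype.card K := by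
  -- Off the diagonal the covariances vanish by independence; on it they are at most 1.
  have hcov : ∀ k j : K, ∑ e, (piDist fun _ : K => l).weights e * (g (e k) * g (e j)) ≤
      if k = j then 1 else 0 := by
    intro k j
    split_ifs with hkj
    · rw [← sum_weights_univ (piDist fun _ : K => l)]
      refine Finset.sum_le_sum fun e _ => mul_le_of_le_one_right ((piDist fun _ => l).nonneg e) ?_
      rw [hkj, ← sq, sq_le_one_iff_abs_le_one]
      exact h1 _
    · refine le_of_eq ?_
      have h := sum_piDist_mul_prod (fun _ : K => l) fun i t =>
        (if i = k then g t else 1) * (if i = j then g t else 1)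
      rw [sum_support_eq_sum_univ] at h
      simp only [Finset.prod_mul_distrib, Finset.prod_ite_eq', Finset.mem_univ, if_true] at h
      rw [h]
      refine Finset.prod_eq_zero (Finset.mem_univ k) ?_
      rw [sum_support_eq_sum_univ]
      simpa [hkj] using h0
  have e : ∀ e : K → T, (piDist fun _ : K => l).weights e * (∑ k, g (e k)) ^ 2 =
      ∑ k, ∑ j, (piDist fun _ : K => l).weights e * (g (e k) * g (e j)) := fun e => by
    rw [sq, Finset.sum_mul_sum, Finset.mul_sum]
    exact Finset.sum_congr rfl fun k _ => Finset.mul_sum _ _ _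
  rw [Finset.sum_congr rfl fun x _ => e x, Finset.sum_comm]
  calc ∑ k, ∑ x : K → T, ∑ j, (piDist fun _ : K => l).weights x * (g (x k) * g (x j))
      = ∑ k, ∑ j, ∑ x : K → T, (piDist fun _ : K => l).weights x * (g (x k) * g (x j)) :=
        Finset.sum_congr rfl fun k _ => Finset.sum_comm
    _ ≤ ∑ k : K, ∑ j : K, if k = j then (1 : ℝ) else 0 :=
        Finset.sum_le_sum fun k _ => Finset.sum_le_sum fun j _ => hcov k j
    _ = Fintype.card K := by simp

/-- The mean deviation of the number of occurrences of a letter in a random word. -/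
theorem sum_piDist_mul_abs_count_le [DecidableEq T] [DecidableEq K] (l : StdSimplex ℝ T) (a : T) :
    ∑ e, (piDist fun _ : K => l).weights e *
      |(∑ k, if e k = a then (1 : ℝ) else 0) - l.weights a * Fintype.card K| ≤
      √(Fintype.card K) := by
  rcases Nat.eq_zero_or_pos (Fintype.card K) with hK | hK
  · have : IsEmpty K := Fintype.card_eq_zero_iff.1 hK
    simp
  set s : ℝ := √(Fintype.card K) with hs
  have hspos : 0 < s := Real.sqrt_pos.2 (Nat.cast_pos.2 hK)
  have hss : s * s = Fintype.card K := Real.mul_self_sqrt (Nat.cast_nonneg _)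
  set g : T → ℝ := fun t => (if t = a then (1 : ℝ) else 0) - l.weights a with hg
  have h0 : ∑ t, l.weights t * g t = 0 := by
    simp only [hg, mul_sub, Finset.sum_sub_distrib, mul_ite, mul_one, mul_zero,
      Finset.sum_ite_eq', Finset.mem_univ, if_true, ← Finset.sum_mul, sum_weights_univ, one_mul,
      sub_self]
  have h1 : ∀ t, |g t| ≤ 1 := fun t => by
    have hn : 0 ≤ l.weights a := l.nonneg a
    have hl := weights_le_one l a
    simp only [hg]
    rw [abs_le]
    split_ifs <;> constructor <;> linarith
  have h2 := sum_piDist_mul_sq_le (K := K) l g h0 h1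
  have hsum : ∀ e : K → T, (∑ k, if e k = a then (1 : ℝ) else 0) - l.weights a * Fintype.card K =
      ∑ k, g (e k) := fun e => by
    simp only [hg, Finset.sum_sub_distrib, Finset.sum_const, Finset.card_univ, nsmul_eq_mul]
    ring
  simp only [hsum]
  -- This bound by the square replaces the Cauchy–Schwarz inequality. With `s = √|K|` the variance
  -- bound makes both terms equal to `s / 2`.
  have h3 : ∀ x : ℝ, |x| ≤ x ^ 2 / (2 * s) + s / 2 := fun x => by
    have h4 : x ^ 2 / (2 * s) + s / 2 - |x| = (|x| - s) ^ 2 / (2 * s) := by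
      rw [sub_sq, sq_abs]
      field_simp
      ring
    have h5 : 0 ≤ (|x| - s) ^ 2 / (2 * s) := by positivity
    linarith
  calc ∑ e, (piDist fun _ : K => l).weights e * |∑ k, g (e k)|
      ≤ ∑ e, (piDist fun _ : K => l).weights e * ((∑ k, g (e k)) ^ 2 / (2 * s) + s / 2) :=
        Finset.sum_le_sum fun e _ =>
          mul_le_mul_of_nonneg_left (h3 _) ((piDist fun _ : K => l).nonneg e)
    _ = (∑ e, (piDist fun _ : K => l).weights e * (∑ k, g (e k)) ^ 2) / (2 * s) + s / 2 := by
        simp only [mul_add, Finset.sum_add_distrib]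
        rw [← Finset.sum_mul, sum_weights_univ, one_mul, Finset.sum_div]
        simp only [mul_div_assoc]
    _ ≤ (s * s) / (2 * s) + s / 2 := by
        rw [hss]
        gcongr
    _ = s := by field_simp; ring

end Words

/-! ### Random atoms and mixtures over random words -/

theorem map_fun_id {α : Type*} (l : StdSimplex ℝ α) : l.map (fun x => x) = l := StdSimplex.map_id l

/-- The law of a random atom. -/
def atomLaw (X : FinProb.{u}) : StdSimplex ℝ X.Atom where
  weights := Finsupp.onFinset Finset.univ (fun a => X.p a.1) fun _ _ => Finset.mem_univ _
  nonneg := fun a => X.law.nonneg a.1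
  total := by
    rw [Finsupp.onFinset_sum _ (fun _ => rfl), ← sum_weights X.law]
    exact Finset.sum_coe_sort _ fun x => X.law.weights x

theorem atomLaw_weights (X : FinProb.{u}) (a : X.Atom) : X.atomLaw.weights a = X.p a.1 := rfl

theorem shannon_atomLaw (X : FinProb.{u}) : shannon X.atomLaw = X.entropy := by
  rw [shannon_univ]
  exact Finset.sum_coe_sort _ fun x => Real.negMulLog (X.law.weights x)

/-- The pair `(t, x)` is determined by its components, so forgetting the index costs at most the
entropy of `m`. -/
theorem shannon_mixDist_le {T : Type*} [Fintype T] {α : Type*} (m : StdSimplex ℝ T)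
    (q : T → StdSimplex ℝ α) :
    shannon (mixDist m q) ≤ shannon m + shannon ((mixDist m q).map fun z => z.2) := by
  have hinj : Function.Injective fun z : Σ _ : T, α => (z.1, z.2) := by
    rintro ⟨t, x⟩ ⟨t', x'⟩ hz
    obtain ⟨rfl, rfl⟩ : t = t' ∧ x = x' := Prod.ext_iff.1 hz
    rfl
  have h := shannon_le_add (mixDist m q) Sigma.fst (fun z => z.2) hinj.injOn
  rwa [mixDist_map_fst] at h

/-- Expanding a product of sums over letters gives a sum of products over words: choosing a random
word and then independent points is the same as mixing in each coordinate separately. -/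
theorem mixDist_piDist_map_snd {T : Type*} [Fintype T] {α : Type*} {K : Type*} [Fintype K]
    [DecidableEq K] (m : StdSimplex ℝ T) (q : T → StdSimplex ℝ α) :
    (mixDist (piDist fun _ : K => m) fun e => piDist fun k => q (e k)).map (fun z => z.2) =
      piDist fun _ : K => (mixDist m q).map fun z => z.2 := by
  ext y
  rw [weights_mixDist_map _ _ fun _ x => x]
  simp only [piDist_weights, weights_mixDist_map m q fun _ x => x]
  rw [Finset.prod_univ_sum, Fintype.piFinset_univ]
  refine Finset.sum_congr rfl fun e _ => ?_
  rw [Finset.prod_mul_distrib]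
  refine congrArg _ ?_
  rw [map_fun_id, piDist_weights]
  simp only [map_fun_id]

end FinProb

section Diagrams

variable {G : Type v} [Category.{w} G]

namespace Diagram

open TropicalProb.FinProb (MPMap rep)

/-! ### Tensor products of coloured families -/

section Coloured

theorem sum_comp_eq {K U : Type*} [Fintype K] [Fintype U] [DecidableEq U] (c : K → U)
    (F : U → ℝ) : ∑ k, F (c k) = ∑ u, (∑ k, if c k = u then (1 : ℝ) else 0) * F u := by
  simp only [Finset.sum_mul]
  rw [Finset.sum_comm]
  simp

/-- Supplies the index embeddings for marginalizing a product with `m u` factors of each colour `u`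
to a product coloured by `c`. -/
theorem exists_injective_sigma {K U : Type*} [Fintype K] [DecidableEq U] (c : K → U)
    (m : U → ℕ) (h : ∀ u, Fintype.card {k // c k = u} ≤ m u) :
    ∃ idx : ∀ k, Fin (m (c k)),
      Function.Injective fun k => (⟨c k, idx k⟩ : Σ u, Fin (m u)) := by
  have e : ∀ u, {k // c k = u} ↪ Fin (m u) := fun u =>
    (Function.Embedding.nonempty_of_card_le (by rw [Fintype.card_fin]; exact h u)).some
  refine ⟨fun k => e (c k) ⟨k, rfl⟩, ?_⟩
  have h1 := Function.Injective.sigma_map (f₁ := (id : U → U)) (β₂ := fun u => Fin (m u))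
    (f₂ := fun u => (e u : {k // c k = u} → Fin (m u)))
    Function.injective_id fun u => (e u).injective
  exact h1.comp (Equiv.sigmaFiberEquiv c).symm.injective

theorem sum_sigma_fst_eq {U : Type*} [Fintype U] [DecidableEq U] (n : U → ℕ) (a : U) :
    (∑ s : Σ a, Fin (n a), if s.1 = a then (1 : ℝ) else 0) = n a := by
  rw [Fintype.sum_sigma, Finset.sum_eq_single a]
  · simp
  · intro b _ hb
    simp [hb]
  · exact fun h => absurd (Finset.mem_univ a) h

variable [Fintype G]

/-- The sum of the entropies of the spaces of a diagram. -/
def totalEntropy (X : Diagram.{u} G) : ℝ := ∑ i, (X.obj i).entropy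

theorem totalEntropy_nonneg (X : Diagram.{u} G) : 0 ≤ X.totalEntropy :=
  Finset.sum_nonneg fun i _ => (X.obj i).entropy_nonneg

/-- Two tensor products of members of the same family of diagrams are close if every member occurs
about the same number of times in both. -/
theorem ikd_tensorFam_le {U K L : Type u} [Fintype U] [DecidableEq U] [Fintype K] [Fintype L]
    (D : U → Diagram.{u} G) (c : K → U) (d : L → U) :
    ikd (tensorFam fun k => D (c k)) (tensorFam fun l => D (d l)) ≤
      ∑ a, |(∑ k, if c k = a then (1 : ℝ) else 0) - ∑ l, if d l = a then (1 : ℝ) else 0| *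
        (D a).totalEntropy := by
  -- The top of the fan contains each factor as often as the larger of its two multiplicities. Twice
  -- the maximum minus both multiplicities is the absolute difference.
  set m : U → ℕ := fun a => max (Fintype.card {k // c k = a}) (Fintype.card {l // d l = a})
  obtain ⟨x, hx⟩ := exists_injective_sigma c m fun a => le_max_left _ _
  obtain ⟨y, hy⟩ := exists_injective_sigma d m fun a => le_max_right _ _
  refine (ikd_le_kd ⟨tensorFam fun s : Σ a, Fin (m a) => D s.1,
    tensorFamRestrict (fun s : Σ a, Fin (m a) => D s.1) _ hx,
    tensorFamRestrict (fun s : Σ a, Fin (m a) => D s.1) _ hy⟩).trans_eq ?_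
  rw [Fan.kd_eq]
  simp only [totalEntropy, Finset.mul_sum]
  rw [Finset.sum_comm]
  refine Finset.sum_congr rfl fun i _ => ?_
  rw [entropy_tensorFam, entropy_tensorFam, entropy_tensorFam,
    sum_comp_eq c fun a => ((D a).obj i).entropy, sum_comp_eq d fun a => ((D a).obj i).entropy,
    Fintype.sum_sigma, Finset.mul_sum, ← Finset.sum_sub_distrib, ← Finset.sum_sub_distrib]
  refine Finset.sum_congr rfl fun a _ => ?_
  have hcard : ∀ {K : Type u} [Fintype K] (c : K → U), (∑ k, if c k = a then (1 : ℝ) else 0) =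
      Fintype.card {k // c k = a} := fun c => by
    rw [Finset.sum_boole, Fintype.card_subtype]
  rw [hcard c, hcard d]
  simp only [Finset.sum_const, Finset.card_univ, Fintype.card_fin, nsmul_eq_mul, m, Nat.cast_max]
  have h := max_sub_min_eq_abs (Fintype.card {k // c k = a} : ℝ) (Fintype.card {l // d l = a})
  have h' := max_add_min (Fintype.card {k // c k = a} : ℝ) (Fintype.card {l // d l = a})
  rw [abs_sub_comm, ← h]
  linear_combination ((D a).obj i).entropy * h'

end Coloured

/-! ### Tensor powers and identifications at distance zero -/

section Power

variable [Fintype G]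

theorem ikd_tensorFam_power (X : Diagram.{u} G) (n : ℕ) :
    ikd (tensorFam fun _ : ULift.{u} (Fin n) => X) (X.power n) = 0 :=
  ikd_eq_zero_of_hom (tensorFamPower X n) fun i => by
    rw [entropy_power, entropy_tensorFam, Finset.sum_const, Finset.card_univ, Fintype.card_ulift,
      Fintype.card_fin, nsmul_eq_mul]

theorem ikd_tensorFam_tensor {K L : Type u} [Fintype K] [Fintype L] (X : K ⊕ L → Diagram.{u} G) :
    ikd (tensorFam X)
      ((tensorFam fun k => X (Sum.inl k)).tensor (tensorFam fun l => X (Sum.inr l))) = 0 :=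
  ikd_eq_zero_of_hom (tensorFamSum X) fun i => by
    rw [entropy_tensor, entropy_tensorFam, entropy_tensorFam, entropy_tensorFam,
      Fintype.sum_sum_type]

theorem ikd_tensor_eq_zero {X X' Y Y' : Diagram.{u} G} (h : ikd X Y = 0) (h' : ikd X' Y' = 0) :
    ikd (X.tensor X') (Y.tensor Y') = 0 :=
  le_antisymm ((ikd_tensor_le X X' Y Y').trans_eq (by rw [h, h', add_zero])) (ikd_nonneg _ _)

def powerOne (X : Diagram.{u} G) : X.power 1 ⟶ X :=
  homMk (fun φ => MPMap.tensorFam fun _ => rep (X.map φ))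
    (fun φ => rep (X.map φ)) (fun _ => rfl) (fun φ => map_eq_toHom_rep X φ)
    (fun i => ⟨Equiv.funUnique (Fin 1) (X.obj i).carrier,
      FinProb.map_equiv _ _ _ fun x =>
        (Fin.prod_univ_one fun k => (X.obj i).law.weights (x k)).symm⟩)
    (fun _ _ _ => rfl)

theorem ikd_power_one (X : Diagram.{u} G) : ikd (X.power 1) X = 0 :=
  ikd_eq_zero_of_hom (powerOne X) fun i => by rw [entropy_power, Nat.cast_one, one_mul]

variable {U : Type u} [Fintype U] (D : U → Diagram.{u} G)

theorem ikd_tensorFam_sigma (n : U → ℕ) : ikd (tensorFam fun s : Σ a, Fin (n a) => D s.1)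
    (tensorFam fun a => (D a).power (n a)) = 0 :=
  ikd_eq_zero_of_hom (tensorFamSigma D n) fun i => by
    rw [entropy_tensorFam, entropy_tensorFam, Fintype.sum_sigma]
    refine Finset.sum_congr rfl fun a _ => ?_
    simp only [entropy_power, Finset.sum_const, Finset.card_univ, Fintype.card_fin, nsmul_eq_mul]

section Triangle

variable [IndexingCategory G] [Nonempty G]

theorem ikd_le_of_ikd_eq_zero {X X' Y Y' : Diagram.{u} G} (hX : ikd X X' = 0)
    (hY : ikd Y Y' = 0) : ikd X Y ≤ ikd X' Y' := by
  have h1 := ikd_triangle X X' Y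
  have h2 := ikd_triangle X' Y' Y
  rw [ikd_comm Y' Y] at h2
  linarith

theorem ikd_eq_zero_trans {X Y Z : Diagram.{u} G} (h : ikd X Y = 0) (h' : ikd Y Z = 0) :
    ikd X Z = 0 :=
  le_antisymm ((ikd_triangle X Y Z).trans_eq (by rw [h, h', add_zero])) (ikd_nonneg X Z)

theorem ikd_power_add (X : Diagram.{u} G) (n m : ℕ) :
    ikd (X.power (n + m)) ((X.power n).tensor (X.power m)) = 0 := by
  -- With a single colour only the number of factors matters, and it is `n + m` on both sides.
  have h1 := ikd_tensorFam_le (U := PUnit) (K := ULift.{u} (Fin (n + m)))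
    (L := ULift.{u} (Fin n) ⊕ ULift.{u} (Fin m)) (fun _ => X) (fun _ => PUnit.unit)
    fun _ => PUnit.unit
  have h2 := le_antisymm (h1.trans_eq (by simp)) (ikd_nonneg _ _)
  have h0 := ikd_tensorFam_power X (n + m)
  rw [ikd_comm] at h0
  exact ikd_eq_zero_trans h0 (ikd_eq_zero_trans h2 (ikd_eq_zero_trans (ikd_tensorFam_tensor _)
    (ikd_tensor_eq_zero (ikd_tensorFam_power X n) (ikd_tensorFam_power X m))))

theorem subadditive_ikd_power (X Y : Diagram.{u} G) :
    Subadditive fun n => ikd (X.power n) (Y.power n) := fun n m =>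
  (ikd_le_of_ikd_eq_zero (ikd_power_add X n m) (ikd_power_add Y n m)).trans (ikd_tensor_le _ _ _ _)

variable [DecidableEq U]

theorem ikd_tensorFam_tensorFam_power_le {K : Type u} [Fintype K] (c : K → U) (n : U → ℕ) :
    ikd (tensorFam fun k => D (c k)) (tensorFam fun a => (D a).power (n a)) ≤
      ∑ a, |(∑ k, if c k = a then (1 : ℝ) else 0) - n a| * (D a).totalEntropy := by
  have h := ikd_tensorFam_le D c (Sigma.fst : (Σ a, Fin (n a)) → U)
  simp only [sum_sigma_fst_eq] at h
  have h' := ikd_tensorFam_sigma D n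
  rw [ikd_comm] at h'
  exact (ikd_le_of_ikd_eq_zero (ikd_self _) h').trans h

theorem ikd_tensorFam_power_tensor_le (n n' n'' : U → ℕ) :
    ikd (tensorFam fun a => (D a).power (n a))
      ((tensorFam fun a => (D a).power (n' a)).tensor (tensorFam fun a => (D a).power (n'' a))) ≤
      ∑ a, |(n' a : ℝ) + n'' a - n a| * (D a).totalEntropy := by
  -- The tensor product on the right is one product over a disjoint union of index sets, in which
  -- the colour `a` occurs `n' a + n'' a` times.
  set c : (Σ a, Fin (n' a)) ⊕ (Σ a, Fin (n'' a)) → U := Sum.elim Sigma.fst Sigma.fst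
  have h := ikd_tensorFam_tensorFam_power_le D c n
  have e : ∀ a, (∑ k, if c k = a then (1 : ℝ) else 0) = n' a + n'' a := fun a =>
    (Fintype.sum_sum_type _).trans
      (congrArg₂ (· + ·) (sum_sigma_fst_eq n' a) (sum_sigma_fst_eq n'' a))
  simp only [e] at h
  rw [ikd_comm]
  refine (ikd_le_of_ikd_eq_zero ?_ (ikd_self _)).trans h
  rw [ikd_comm]
  exact ikd_eq_zero_trans (ikd_tensorFam_tensor _)
    (ikd_tensor_eq_zero (ikd_tensorFam_sigma D n') (ikd_tensorFam_sigma D n''))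

end Triangle

end Power

/-! ### Conditioning on words -/

section Words

variable (A : Diagram.{u} G) (ι : G) (K : Type u) [Fintype K]

/-- The law of a random word of atoms. -/
abbrev wordLaw : StdSimplex ℝ (K → (A.obj ι).Atom) := FinProb.piDist fun _ : K => (A.obj ι).atomLaw

theorem shannon_wordLaw :
    FinProb.shannon (wordLaw A ι K) = Fintype.card K * (A.obj ι).entropy := by
  rw [FinProb.shannon_piDist, Finset.sum_const, Finset.card_univ, nsmul_eq_mul,
    FinProb.shannon_atomLaw]

end Words

section Conditioning

variable [Fintype G] [IndexingCategory G] [Nonempty G] (A : Diagram.{u} G) (ι : G)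

/-- The normalizing constant of the conditioned law is the mass of the fibre over `a`, which is
`p(a)`. -/
theorem p_mul_condInitial_weights [DecidableEq (A.obj ι).carrier] (a : (A.obj ι).Atom)
    (x : (A.obj (initialObj G)).carrier) :
    (A.obj ι).p a.1 * (condInitial A ι a).weights x =
      if (rep (A.map (fromInitial ι))).1 x = a.1 then (A.obj (initialObj G)).law.weights x
      else 0 := by
  classical
  have hn : (((A.obj (initialObj G)).law.weights.filter
      (· ∈ (rep (A.map (fromInitial ι))).1 ⁻¹' {a.1})).sum fun _ k => k) = (A.obj ι).p a.1 := by
    have h := congrArg (fun l => l.weights a.1) (rep (A.map (fromInitial ι))).2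
    rw [FinProb.p]
    refine Eq.trans ?_ h
    rw [FinProb.weights_map_eq, Finsupp.sum, Finsupp.support_filter]
    refine Finset.sum_congr ?_ fun y hy => Finsupp.filter_apply_pos _ _ ?_
    · ext y
      simp
    · simpa using (Finset.mem_filter.1 hy).2
  have hp : (A.obj ι).p a.1 ≠ 0 := Finsupp.mem_support_iff.1 a.2
  rw [condInitial, StdSimplex.weights_restrict, hn, Finsupp.smul_apply, smul_eq_mul,
    mul_inv_cancel_left₀ hp, Finsupp.filter_apply]
  simp

/-- Every atom of the initial space lies over exactly one atom of `E`, so averaging the conditioned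
laws restores the original one. -/
theorem mixDist_condInitial_map_snd :
    (FinProb.mixDist (A.obj ι).atomLaw fun a => condInitial A ι a).map (fun z => z.2) =
      (A.obj (initialObj G)).law := by
  classical
  ext x
  rw [FinProb.weights_mixDist_map _ _ fun _ x => x]
  simp only [FinProb.map_fun_id, FinProb.atomLaw_weights, p_mul_condInitial_weights]
  by_cases hx : x ∈ (A.obj (initialObj G)).law.weights.support
  · rw [Finset.sum_eq_single ⟨_, (rep (A.map (fromInitial ι))).mem hx⟩]
    · rw [if_pos rfl]
    · intro b _ hb
      exact if_neg fun hb' => hb (Subtype.ext hb'.symm)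
    · exact fun h => absurd (Finset.mem_univ _) h
  · simp [Finsupp.notMem_support_iff.1 hx]

theorem mixDist_condLaw_map_snd (i : G) :
    (FinProb.mixDist (A.obj ι).atomLaw fun a => condLaw A ι a i).map (fun z => z.2) =
      (A.obj i).law := by
  have h := FinProb.mixDist_map (A.obj ι).atomLaw (fun a => condInitial A ι a)
    fun _ => (rep (A.map (fromInitial i))).1
  have h' : (FinProb.mixDist (A.obj ι).atomLaw fun a => condLaw A ι a i).map (fun z => z.2) =
      ((FinProb.mixDist (A.obj ι).atomLaw fun a => condInitial A ι a).map (fun z => z.2)).map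
        (rep (A.map (fromInitial i))).1 := by
    rw [StdSimplex.map_map]
    exact (congrArg (StdSimplex.map _) h.symm).trans (StdSimplex.map_map _ _ _)
  rw [h', mixDist_condInitial_map_snd]
  exact (rep (A.map (fromInitial i))).2

variable (K : Type u) [Fintype K] [DecidableEq K]

/-- The mixture, over all words of atoms, of the products of the conditioned diagrams. -/
abbrev wordMix : Diagram.{u} G := mix (wordLaw A ι K) fun e => tensorFam fun k => A.cond ι (e k)

/-- Forgets the word; total probability in each coordinate shows that the laws match. -/
def wordMixHom : wordMix A ι K ⟶ tensorFam fun _ : K => A :=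
  homMk (fun φ => ⟨fun z => ⟨z.1, (rep ((tensorFam fun k => A.cond ι (z.1 k)).map φ)).1 z.2⟩, _⟩)
    (fun φ => MPMap.tensorFam fun _ => rep (A.map φ)) (fun _ => rfl) (fun _ => rfl)
    (fun i => ⟨fun z => z.2, by
      refine (FinProb.mixDist_piDist_map_snd (K := K) (A.obj ι).atomLaw
        fun a => condLaw A ι a i).trans ?_
      rw [mixDist_condLaw_map_snd]
      rfl⟩)
    (fun φ z hz => by
      have hz' := ((FinProb.mem_support_mixDist _ _ z).1 hz).2
      have h1 := FinProb.toHom_eq.1 (FinProb.toHom_rep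
        ((tensorFam fun k => A.cond ι (z.1 k)).map φ)) _ hz'
      refine h1.trans (funext fun k => ?_)
      exact FinProb.toHom_eq.1 (FinProb.toHom_rep ((A.cond ι (z.1 k)).map φ)) _
        ((FinProb.mem_support_piDist _ _).1 hz' k))

/-- On each space the reduction `wordMixHom` loses at most the entropy of the forgotten word. -/
theorem ikd_wordMix_le : ikd (wordMix A ι K) (tensorFam fun _ : K => A) ≤
    Fintype.card G * (Fintype.card K * (A.obj ι).entropy) := by
  refine (ikd_le_of_hom (wordMixHom A ι K)).trans ?_
  rw [← Finset.card_univ (α := G), ← nsmul_eq_mul, ← Finset.sum_const]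
  refine Finset.sum_le_sum fun i _ => ?_
  rw [← shannon_wordLaw, sub_le_iff_le_add]
  have h := FinProb.shannon_mixDist_le (wordLaw A ι K)
    fun e => FinProb.piDist fun k => condLaw A ι (e k) i
  rw [FinProb.mixDist_piDist_map_snd (A.obj ι).atomLaw fun a => condLaw A ι a i,
    mixDist_condLaw_map_snd] at h
  exact h

end Conditioning

end Diagram

/-! ## Asymptotic distances -/

namespace DiagramSeq

open Diagram

variable [Fintype G]

theorem mem_tropicalClass_self {X : DiagramSeq.{u} G} (h : QuasiLinear X) :
    X ∈ tropicalClass X := by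
  refine ⟨h, ?_⟩
  simp only [HasAsympDist, ikd_self, zero_div]
  exact tendsto_const_nhds

variable [IndexingCategory G] [Nonempty G]

/-- Fekete's lemma for `a + C`, which is truly subadditive. -/
theorem exists_tendsto_div_of_le_add {a : ℕ → ℝ} {C : ℝ} (h0 : ∀ n, 0 ≤ a n) (hC : 0 ≤ C)
    (h : ∀ m n, a (m + n) ≤ a m + a n + C) : ∃ d, Tendsto (fun n : ℕ => a n / n) atTop (𝓝 d) := by
  have hs : Subadditive fun n => a n + C := fun m n => by linarith [h m n]
  have hb : BddBelow (Set.range fun n : ℕ => (a n + C) / n) :=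
    ⟨0, by rintro _ ⟨n, rfl⟩; exact div_nonneg (add_nonneg (h0 n) hC) (Nat.cast_nonneg n)⟩
  refine ⟨hs.lim - 0, ((hs.tendsto_lim hb).sub (tendsto_const_div_atTop_nhds_zero_nat C)).congr
    fun n => ?_⟩
  rw [← sub_div, add_sub_cancel_right]

/-- The Fekete limit is an infimum, so it is at most the term at `n = 1`. -/
theorem exists_hasAsympDist_linear (X Y : Diagram.{u} G) :
    ∃ d, HasAsympDist (linear X) (linear Y) d ∧ d ≤ ikd X Y := by
  have hs := subadditive_ikd_power X Y
  have hb : BddBelow (Set.range fun n : ℕ => ikd (X.power n) (Y.power n) / n) :=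
    ⟨0, by rintro _ ⟨n, rfl⟩; exact div_nonneg (ikd_nonneg _ _) (Nat.cast_nonneg n)⟩
  refine ⟨hs.lim, hs.tendsto_lim hb, (hs.lim_le_div hb one_ne_zero).trans ?_⟩
  rw [Nat.cast_one, div_one]
  exact ikd_le_of_ikd_eq_zero (ikd_power_one X) (ikd_power_one Y)

theorem admissible_one : Admissible fun _ => 1 := by
  -- The integral of `s ^ (-2)` over `(t, ∞)` is `1 / t`, so `D = 8` gives equality.
  refine ⟨fun _ _ => zero_le_one, monotoneOn_const, 8, fun t ht => ?_⟩
  have ht0 : 0 < t := zero_lt_one.trans_le ht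
  have e : ∀ s ∈ Set.Ioi t, (1 : ℝ) / s ^ 2 = s ^ (-2 : ℝ) := fun s hs => by
    rw [Real.rpow_neg (ht0.trans hs).le, Real.rpow_two, one_div]
  refine ⟨(integrableOn_Ioi_rpow_of_lt (by norm_num : (-2 : ℝ) < -1) ht0).congr_fun
    (fun s hs => (e s hs).symm) measurableSet_Ioi, ?_⟩
  rw [MeasureTheory.setIntegral_congr_fun measurableSet_Ioi e,
    integral_Ioi_rpow_of_lt (by norm_num) ht0]
  norm_num
  rw [Real.rpow_neg_one, mul_assoc, mul_inv_cancel₀ ht0.ne', mul_one]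

/-- A uniform bound on the intrinsic distances also bounds the asymptotic defects, so a constant `φ`
suffices. -/
theorem quasiLinear_of_le {X : DiagramSeq.{u} G} {C : ℝ}
    (h : ∀ n m, ikd (X (n + m)) ((X n).tensor (X m)) ≤ C) : QuasiLinear X :=
  ⟨fun _ => 1, admissible_one, C, fun n m _ => by
    obtain ⟨d, hd, hd'⟩ := exists_hasAsympDist_linear (X (n + m)) ((X n).tensor (X m))
    exact ⟨d, hd, by rw [mul_one]; exact hd'.trans (h n m)⟩⟩

/-- By the triangle inequality, replacing both sequences changes the distance at `n` by at most the
sum of the two replacement distances, which is `o(n)`. -/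
theorem HasAsympDist.congr {X X' Y Y' : DiagramSeq.{u} G} {d : ℝ} (h : HasAsympDist X Y d)
    (hX : HasAsympDist X X' 0) (hY : HasAsympDist Y Y' 0) : HasAsympDist X' Y' d := by
  have h0 := hX.add hY
  rw [add_zero] at h0
  have h1 : Tendsto (fun n : ℕ => ikd (X' n) (Y' n) / n - ikd (X n) (Y n) / n) atTop (𝓝 0) := by
    refine squeeze_zero_norm (fun n => ?_) h0
    rw [Real.norm_eq_abs, ← sub_div, ← add_div, abs_div, Nat.abs_cast]
    refine div_le_div_of_nonneg_right ?_ (Nat.cast_nonneg n)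
    have a1 := ikd_triangle (X n) (X' n) (Y n)
    have a2 := ikd_triangle (X' n) (Y' n) (Y n)
    have a3 := ikd_triangle (X' n) (X n) (Y' n)
    have a4 := ikd_triangle (X n) (Y n) (Y' n)
    rw [ikd_comm (Y' n) (Y n)] at a2
    rw [ikd_comm (X' n) (X n)] at a3
    rw [abs_le]
    constructor <;> linarith
  have h2 := h1.add h
  rw [zero_add] at h2
  exact h2.congr fun n => sub_add_cancel _ _

theorem ikd_linear_add_le (A : Diagram.{u} G) (n m : ℕ) :
    ikd (linear A (n + m)) ((linear A n).tensor (linear A m)) ≤ 0 :=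
  (ikd_power_add A n m).le

/-! ### Quasi-linearity, existence of the limit and the bound for `linear A` and `cond A ι` -/

variable (A : Diagram.{u} G) (ι : G)

/-- The floor function is additive up to an error between 0 and 1, so the multiplicity of each
conditioned diagram is off by at most one. -/
theorem ikd_cond_add_le (n m : ℕ) :
    ikd (cond A ι (n + m)) ((cond A ι n).tensor (cond A ι m)) ≤
      ∑ a, (A.cond ι a).totalEntropy := by
  classical
  refine (ikd_tensorFam_power_tensor_le (A.cond ι) (fun a => ⌊(A.obj ι).p a.1 * (n + m : ℕ)⌋₊)
    (fun a => ⌊(A.obj ι).p a.1 * n⌋₊) fun a => ⌊(A.obj ι).p a.1 * m⌋₊).trans ?_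
  refine Finset.sum_le_sum fun a _ => mul_le_of_le_one_left (totalEntropy_nonneg _) ?_
  have hp : 0 ≤ (A.obj ι).p a.1 := (A.obj ι).law.nonneg a.1
  set x := (A.obj ι).p a.1 * n with hx
  set y := (A.obj ι).p a.1 * m with hy
  have hx0 : 0 ≤ x := by positivity
  have hy0 : 0 ≤ y := by positivity
  have e : (A.obj ι).p a.1 * (n + m : ℕ) = x + y := by rw [Nat.cast_add, mul_add]
  rw [e]
  have l2 : ⌊x⌋₊ + ⌊y⌋₊ ≤ ⌊x + y⌋₊ := Nat.le_floor (by
    rw [Nat.cast_add]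
    exact add_le_add (Nat.floor_le hx0) (Nat.floor_le hy0))
  have l1' : (⌊x + y⌋₊ : ℝ) ≤ ⌊x⌋₊ + ⌊y⌋₊ + 1 := by
    have l3 : ⌊x + y⌋₊ < ⌊x⌋₊ + ⌊y⌋₊ + 2 := (Nat.floor_lt (add_nonneg hx0 hy0)).2 (by
      push_cast
      linarith [Nat.lt_floor_add_one x, Nat.lt_floor_add_one y])
    exact_mod_cast Nat.lt_succ_iff.1 l3
  have l2' : (⌊x⌋₊ + ⌊y⌋₊ : ℝ) ≤ ⌊x + y⌋₊ := by exact_mod_cast l2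
  rw [abs_le]
  constructor <;> linarith

theorem quasiLinear_linear : QuasiLinear (linear A) := quasiLinear_of_le (ikd_linear_add_le A)

theorem quasiLinear_cond : QuasiLinear (cond A ι) := quasiLinear_of_le (ikd_cond_add_le A ι)

/-- Both sequences are additive up to a bounded error and the distance is subadditive under tensor
products, so Fekete's lemma applies up to a constant. -/
theorem exists_hasAsympDist_linear_cond : ∃ d, HasAsympDist (linear A) (cond A ι) d := by
  refine exists_tendsto_div_of_le_add (C := ∑ a, (A.cond ι a).totalEntropy)
    (fun n => ikd_nonneg _ _) (Finset.sum_nonneg fun a _ => totalEntropy_nonneg _) fun n m => ?_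
  have h1 := ikd_linear_add_le A n m
  have h2 := ikd_cond_add_le A ι n m
  have h3 := ikd_triangle (linear A (n + m)) ((linear A n).tensor (linear A m)) (cond A ι (n + m))
  have h4 := ikd_triangle ((linear A n).tensor (linear A m))
    ((cond A ι n).tensor (cond A ι m)) (cond A ι (n + m))
  rw [ikd_comm ((cond A ι n).tensor _) (cond A ι (n + m))] at h4
  have h5 := ikd_tensor_le (linear A n) (linear A m) (cond A ι n) (cond A ι m)
  linarith

/-- The factor 2 comes from the detour through `wordMix`: the entropy of the word is paid once
towards `A ^ n` and once towards `Y(n)`. -/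
theorem ikd_linear_cond_le (n : ℕ) : ikd (linear A n) (cond A ι n) ≤
    2 * Fintype.card G * (A.obj ι).entropy * n +
      (√n + 1) * ∑ a, (A.cond ι a).totalEntropy := by
  classical
  have hK : Fintype.card (ULift.{u} (Fin n)) = n := by simp
  have h1 := ikd_wordMix_le A ι (ULift.{u} (Fin n))
  have h2 := ikd_mix_le (wordLaw A ι (ULift.{u} (Fin n)))
    (fun e => tensorFam fun k => A.cond ι (e k)) (cond A ι n)
  rw [shannon_wordLaw] at h2
  rw [hK] at h1 h2
  have h3 : ∑ e, (wordLaw A ι (ULift.{u} (Fin n))).weights e *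
      ikd (tensorFam fun k => A.cond ι (e k)) (cond A ι n) ≤
      ∑ e, (wordLaw A ι (ULift.{u} (Fin n))).weights e *
        ∑ a, (|(∑ k, if e k = a then (1 : ℝ) else 0) - (A.obj ι).p a.1 * n| + 1) *
          (A.cond ι a).totalEntropy := by
    refine Finset.sum_le_sum fun e _ =>
      mul_le_mul_of_nonneg_left ?_ ((wordLaw A ι _).nonneg e)
    refine (ikd_tensorFam_tensorFam_power_le (A.cond ι) e
      fun a => ⌊(A.obj ι).p a.1 * n⌋₊).trans ?_
    refine Finset.sum_le_sum fun a _ =>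
      mul_le_mul_of_nonneg_right ?_ (totalEntropy_nonneg _)
    -- The extra 1 pays for replacing `⌊n p(a)⌋` by `n p(a)`.
    refine (abs_sub_le _ ((A.obj ι).p a.1 * n) _).trans (add_le_add_right ?_ _)
    have hp : 0 ≤ (A.obj ι).p a.1 * n :=
      mul_nonneg ((A.obj ι).law.nonneg a.1) (Nat.cast_nonneg n)
    have l1 := Nat.floor_le hp
    have l2 := Nat.lt_floor_add_one ((A.obj ι).p a.1 * n)
    rw [abs_le]
    constructor <;> linarith
  -- After exchanging the sums over words and atoms, each atom contributes its mean count deviation,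
  -- at most `√n`.
  have h4 : ∑ e, (wordLaw A ι (ULift.{u} (Fin n))).weights e *
        ∑ a, (|(∑ k, if e k = a then (1 : ℝ) else 0) - (A.obj ι).p a.1 * n| + 1) *
          (A.cond ι a).totalEntropy ≤ (√n + 1) * ∑ a, (A.cond ι a).totalEntropy := by
    simp only [Finset.mul_sum]
    rw [Finset.sum_comm]
    refine Finset.sum_le_sum fun a _ => ?_
    simp only [← mul_assoc]
    rw [← Finset.sum_mul]
    refine mul_le_mul_of_nonneg_right ?_ (totalEntropy_nonneg _)
    simp only [mul_add, mul_one, Finset.sum_add_distrib, FinProb.sum_weights_univ]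
    have h := FinProb.sum_piDist_mul_abs_count_le (K := ULift.{u} (Fin n)) (A.obj ι).atomLaw a
    rw [hK] at h
    exact add_le_add_left h 1
  have h5 := ikd_triangle (linear A n) (tensorFam fun _ : ULift.{u} (Fin n) => A) (cond A ι n)
  have h6 := ikd_triangle (tensorFam fun _ : ULift.{u} (Fin n) => A)
    (wordMix A ι (ULift.{u} (Fin n))) (cond A ι n)
  have h7 : ikd (linear A n) (tensorFam fun _ : ULift.{u} (Fin n) => A) = 0 := by
    rw [ikd_comm]
    exact ikd_tensorFam_power A n
  rw [ikd_comm _ (wordMix A ι _)] at h6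
  linarith

theorem le_of_hasAsympDist_linear_cond {d : ℝ} (h : HasAsympDist (linear A) (cond A ι) d) :
    d ≤ 2 * Fintype.card G * (A.obj ι).entropy := by
  set B := 2 * Fintype.card G * (A.obj ι).entropy
  set C := ∑ a, (A.cond ι a).totalEntropy
  have h1 : Tendsto (fun n : ℕ => 1 / √(n : ℝ)) atTop (𝓝 0) :=
    (tendsto_const_nhds (x := (1 : ℝ))).div_atTop
      (Real.tendsto_sqrt_atTop.comp tendsto_natCast_atTop_atTop)
  have h2 : Tendsto (fun n : ℕ => B + (1 / √(n : ℝ) + 1 / n) * C) atTop (𝓝 (B + (0 + 0) * C)) :=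
    tendsto_const_nhds.add ((h1.add (tendsto_const_div_atTop_nhds_zero_nat 1)).mul_const C)
  rw [add_zero, zero_mul, add_zero] at h2
  refine le_of_tendsto_of_tendsto h h2 ?_
  filter_upwards [eventually_gt_atTop 0] with n hn
  have hn' : (0 : ℝ) < n := Nat.cast_pos.2 hn
  rw [div_le_iff₀ hn']
  refine (ikd_linear_cond_le A ι n).trans_eq ?_
  have hs : √(n : ℝ) * √n = n := Real.mul_self_sqrt hn'.le
  have hs0 : √(n : ℝ) ≠ 0 := (Real.sqrt_pos.2 hn').ne'
  have e : 1 / √(n : ℝ) * n = √n := by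
    rw [div_mul_eq_mul_div, one_mul, div_eq_iff hs0, hs]
  have e' : 1 / (n : ℝ) * n = 1 := one_div_mul_cancel hn'.ne'
  linear_combination -C * e - C * e'

end DiagramSeq

end Diagrams
end TropicalProb
end

theorem corollaryp {G : Type v} [Category.{w} G] [Fintype G] [IndexingCategory G] [Nonempty G]
    (A : Diagram.{u} G) (ι : G) :
    DiagramSeq.linear A ∈ DiagramSeq.tropicalClass (DiagramSeq.linear A) ∧
    DiagramSeq.cond A ι ∈ DiagramSeq.tropicalClass (DiagramSeq.cond A ι) ∧
    ∃ d : ℝ,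
      (∀ X ∈ DiagramSeq.tropicalClass (DiagramSeq.linear A),
        ∀ Y ∈ DiagramSeq.tropicalClass (DiagramSeq.cond A ι), DiagramSeq.HasAsympDist X Y d) ∧
      d ≤ 2 * (Fintype.card G : ℝ) * (A.obj ι).entropy := by
  refine ⟨DiagramSeq.mem_tropicalClass_self (DiagramSeq.quasiLinear_linear A),
    DiagramSeq.mem_tropicalClass_self (DiagramSeq.quasiLinear_cond A ι), ?_⟩
  obtain ⟨d, hd⟩ := DiagramSeq.exists_hasAsympDist_linear_cond A ι
  exact ⟨d, fun X hX Y hY => hd.congr hX.2 hY.2,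
    DiagramSeq.le_of_hasAsympDist_linear_cond A ι hd⟩
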